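/- A polygon is a closed connected bounded region of the plane bounded by one or several pairwise disjoint simple closed polygonal lines (in particular, it need not be simply connected). A polygon is cut into rectangles if it is the union of finitely many nondegenerate rectangles with pairwise disjoint interiors; a rectangle has side ratio $r$ if the ratio of its two side lengths, taken in one of the two orders, is $r$. For $p\in\mathbb{Q}$, $p>0$, put $\mathbb{Q}[\sqrt p]=\{\alpha+\beta\sqrt p:\alpha,\beta\in\mathbb{Q}\}$. Let $a,b,p\in\mathbb{Q}$ with $p>0$, $\sqrt p\notin\mathbb{Q}$ and $a+b\sqrt p>0$. Let $M$ be a polygon all of whose side lengths belong to $\mathbb{Q}[\sqrt p]$, and suppose that $M$ can be cut into equal (that is, congruent) rectangles with side ratio $y\in\mathbb{R}$. Then: 1) If $a-b\sqrt p>0$, then $M$ can be cut into (not necessarily equal) rectangles with side ratio $a+b\sqrt p$ if and only if $$y\in\Bigl\{e+f\sqrt p:\ e,f\in\mathbb{Q},\ e>0,\ \frac{|f|}{e}\le\frac{|b|}{a}\Bigr\}.$$ 2) If $a-b\sqrt p<0$, then $M$ can be cut into (not necessarily equal) rectangles with side ratio $a+b\sqrt p$ if and only if $$y\in\Bigl\{e+f\sqrt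 p:\ e,f\in\mathbb{Q},\ f>0,\ \frac{|e|}{f}\le\frac{|a|}{b}\Bigr\}.$$ -/

import Mathlib

/-! Polygons (possibly with holes) in the Euclidean plane and their dissections into rectangles. -/

namespace RectDissection

/-- The Euclidean plane. -/
abbrev Plane : Type := EuclideanSpace ℝ (Fin 2)

/-- The set `ℚ[√p] = {α + β √p : α, β ∈ ℚ}` of real numbers. -/
def quadRat (p : ℚ) : Set ℝ :=
  {x | ∃ α β : ℚ, x = (α : ℝ) + (β : ℝ) * Real.sqrt (p : ℝ)}

/-- A closed polygonal line with cyclically ordered vertices is simple if it has at least three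
sides, no side is degenerate, consecutive sides meet only in their common vertex, and
non-consecutive sides are disjoint. -/
structure IsSimpleClosed {n : ℕ} (P : Polygon Plane n) : Prop where
  three_le : 3 ≤ n
  nondegenerate : ∀ i, P i ≠ P (finRotate n i)
  consecutive : ∀ i,
    P.edgeSet ℝ i ∩ P.edgeSet ℝ (finRotate n i) = {P (finRotate n i)}
  nonconsecutive : ∀ i j, j ≠ i → j ≠ finRotate n i → i ≠ finRotate n j →
    Disjoint (P.edgeSet ℝ i) (P.edgeSet ℝ j)

/-- `M` is a closed connected bounded region of the plane whose boundary is the union of the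
pairwise disjoint simple closed polygonal lines `P j`. -/
structure IsPolygonWithBoundary (M : Set Plane) {k : ℕ} {n : Fin k → ℕ}
    (P : (j : Fin k) → Polygon Plane (n j)) : Prop where
  isConnected : IsConnected M
  isBounded : Bornology.IsBounded M
  /-- `M` is closed and is a region: it is the closure of its interior. -/
  closure_interior : closure (interior M) = M
  simple : ∀ j, IsSimpleClosed (P j)
  disjoint : ∀ i j, i ≠ j → Disjoint ((P i).boundary ℝ) ((P j).boundary ℝ)
  frontier_eq : frontier M = ⋃ j, (P j).boundary ℝ

/-- `M` is a polygon (not necessarily simply connected) all of whose sides have length in `K`.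
(For `K` closed under addition it makes no difference whether a vertex with a straight angle
is allowed on the boundary.) -/
def IsPolygonWithSidesIn (K : Set ℝ) (M : Set Plane) : Prop :=
  ∃ (k : ℕ) (n : Fin k → ℕ) (P : (j : Fin k) → Polygon Plane (n j)),
    IsPolygonWithBoundary M P ∧
      ∀ (j : Fin k) (i : Fin (n j)), dist (P j i) (P j (finRotate (n j) i)) ∈ K

/-- `S` is a (closed, nondegenerate, arbitrarily placed) rectangle with side lengths
`c` and `d`. -/
def IsRectangle (c d : ℝ) (S : Set Plane) : Prop :=
  0 < c ∧ 0 < d ∧ ∃ O u v : Plane, ‖u‖ = c ∧ ‖v‖ = d ∧ inner ℝ u v = 0 ∧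
    S = {x | ∃ s ∈ Set.Icc (0 : ℝ) 1, ∃ t ∈ Set.Icc (0 : ℝ) 1, x = O + s • u + t • v}

/-- `M` is dissected into the finitely many sets `R i`: their union is `M`, and their
interiors are pairwise disjoint. -/
def IsDissection (M : Set Plane) {N : ℕ} (R : Fin N → Set Plane) : Prop :=
  (⋃ i, R i) = M ∧ ∀ i j, i ≠ j → Disjoint (interior (R i)) (interior (R j))

/-- `M` can be cut into finitely many equal (congruent) rectangles with side ratio `y`. -/
def CutsIntoEqual (M : Set Plane) (y : ℝ) : Prop :=
  ∃ c d : ℝ, c / d = y ∧ ∃ (N : ℕ) (R : Fin N → Set Plane),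
    IsDissection M R ∧ ∀ i, IsRectangle c d (R i)

/-- `M` can be cut into finitely many (similar, not necessarily equal) rectangles with side
ratio `r`. -/
def CutsIntoSimilar (M : Set Plane) (r : ℝ) : Prop :=
  ∃ (N : ℕ) (R : Fin N → Set Plane),
    IsDissection M R ∧ ∀ i, ∃ c d : ℝ, c / d = r ∧ IsRectangle c d (R i)

end RectDissection

/-!
The necessity of the conditions on `y` rests on an additive invariant of plane sets. For additive
functions `f`, `g` on the reals and an orthonormal frame, the sum of `f(width) * g(height)` over the
rectangles of a dissection that are parallel to the frame depends only on the dissected set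
(`HasForm.unique`); rectangles in other positions contribute nothing, so it is not necessary to
know that all rectangles of a dissection are parallel. The reason is local: for almost every point
of a horizontal line, the `jump` of the indicator function across the line is additive over
dissections, a parallel rectangle jumps exactly along its two horizontal sides, a tilted one almost
nowhere, and a relation between indicator functions of intervals passes to the increments of an
arbitrary function `f` over these intervals (`sum_mul_sub_eq_of_ae`). For a polygon, the jump is
constant along every open horizontal side. So the invariant vanishes if `f` vanishes on the side
lengths of the polygon (`HasForm.eq_zero_of_polygon`).

If the polygon with sides in `ℚ[√p]` is cut into `c × d` rectangles, the functions `f` which vanish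
on `ℚ[√p]` must therefore vanish at `c` and `d` (`map_side_eq_zero`), whence `y = c / d` lies in
`ℚ[√p]`. Let `r = a + b √p`, and let `r'`, `y'` be the conjugates of `r`, `y`. Choose an additive `σ`
which is semilinear for the conjugation and has `σ d ≠ 0` (`exists_semilinear`), and combine the
invariants of the pairs `(id, id)`, `(σ, σ)`, `(id, σ)`, `(σ, id)` with weights `A`, `C`, `D`, `D`.
A rectangle with sides `t` and `r t`, in either position, contributes
`A r t² + C r' (σ t)² + D (r + r') t (σ t)`, and a `c × d` rectangle contributes the analogous
expression in `y`, `y'`, `d`. Weights for which the first form is nonnegative make the second one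
nonnegative (`quadratic_form_nonneg`). The optimal weights give `y' r' > 0` and
`|r r'| (y + y')² ≤ |y y'| (r + r')²` (`mul_sq_le_of_forms`), which are the stated bounds.

Conversely, the ratios of rectangles which can be cut into rectangles with side ratio `r` contain
`r` and are closed under addition and inversion, hence under multiplication by positive rationals
(`RatioCuts`). Since `r'` is a rational multiple of `r⁻¹`, they contain all combinations
`q r + s r'`, respectively `q r - s r'` if `r' < 0`, with rational `q, s ≥ 0` not both zero, and these
are exactly the numbers admitted by the bounds.
-/

namespace RectDissection

open MeasureTheory Set Filter Topology

/-! ### Step functions -/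

/-- A linear relation between indicator functions of intervals holds for the increments of any
function `f`: only finitely many values of `f` matter, so `f` may be replaced by an interpolating
polynomial, whose increments are integrals of its derivative. -/
theorem sum_mul_sub_eq_zero_of_ae {ι : Type*} [Fintype ι] {κ a b : ι → ℝ} (hab : ∀ i, a i ≤ b i)
    (h : ∀ᵐ x : ℝ, ∑ i, (Ioo (a i) (b i)).indicator (fun _ => κ i) x = 0) (f : ℝ → ℝ) :
    ∑ i, κ i * (f (b i) - f (a i)) = 0 := by
  classical
  -- `P` takes the values of `f` at all endpoints
  set s : Finset ℝ := Finset.univ.image a ∪ Finset.univ.image b with hs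
  set P : Polynomial ℝ := Lagrange.interpolate s id f with hP
  have hnode : ∀ x ∈ s, P.eval x = f x := fun x hx =>
    Lagrange.eval_interpolate_at_node (v := id) f Function.injective_id.injOn hx
  have ha : ∀ i, P.eval (a i) = f (a i) := fun i => hnode _ (by simp [hs])
  have hb : ∀ i, P.eval (b i) = f (b i) := fun i => hnode _ (by simp [hs])
  have hcont : Continuous fun x => P.derivative.eval x := P.derivative.continuous
  have hint : ∀ i, Integrable ((Ioo (a i) (b i)).indicator fun x => κ i * P.derivative.eval x) := by
    intro i
    rw [integrable_indicator_iff measurableSet_Ioo]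
    exact ((continuous_const.mul hcont).integrableOn_Icc).mono_set Ioo_subset_Icc_self
  have hterm : ∀ i, ∫ x, (Ioo (a i) (b i)).indicator (fun x => κ i * P.derivative.eval x) x
      = κ i * (f (b i) - f (a i)) := by
    intro i
    rw [integral_indicator measurableSet_Ioo, ← integral_Ioc_eq_integral_Ioo,
      ← intervalIntegral.integral_of_le (hab i), intervalIntegral.integral_const_mul,
      intervalIntegral.integral_eq_sub_of_hasDerivAt (fun x _ => P.hasDerivAt x)
        (hcont.intervalIntegrable _ _), ha, hb]
  rw [← Finset.sum_congr rfl fun i _ => hterm i, ← integral_finsetSum _ fun i _ => hint i]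
  refine integral_eq_zero_of_ae ?_
  filter_upwards [h] with x hx
  have : ∀ i, (Ioo (a i) (b i)).indicator (fun x => κ i * P.derivative.eval x) x
      = (Ioo (a i) (b i)).indicator (fun _ => κ i) x * P.derivative.eval x := by
    intro i
    by_cases hi : x ∈ Ioo (a i) (b i) <;> simp [hi]
  simp only [this, ← Finset.sum_mul, hx, zero_mul, Pi.zero_apply]

theorem sum_mul_sub_eq_of_ae {ι ι' : Type*} [Fintype ι] [Fintype ι'] {κ a b : ι → ℝ}
    {κ' a' b' : ι' → ℝ} (hab : ∀ i, a i ≤ b i) (hab' : ∀ i, a' i ≤ b' i)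
    (h : ∀ᵐ x : ℝ, ∑ i, (Ioo (a i) (b i)).indicator (fun _ => κ i) x
      = ∑ i, (Ioo (a' i) (b' i)).indicator (fun _ => κ' i) x) (f : ℝ → ℝ) :
    ∑ i, κ i * (f (b i) - f (a i)) = ∑ i, κ' i * (f (b' i) - f (a' i)) := by
  have := sum_mul_sub_eq_zero_of_ae (ι := ι ⊕ ι') (κ := Sum.elim κ (-κ')) (a := Sum.elim a a')
    (b := Sum.elim b b') (by rintro (i | i) <;> simp [hab, hab']) ?_ f
  · simp only [Fintype.sum_sum_type, Sum.elim_inl, Sum.elim_inr, Pi.neg_apply, neg_mul,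
      Finset.sum_neg_distrib] at this
    linarith
  · filter_upwards [h] with x hx
    have hneg : ∀ i, (Ioo (a' i) (b' i)).indicator (fun _ => -κ' i) x
        = -(Ioo (a' i) (b' i)).indicator (fun _ => κ' i) x := by
      intro i
      by_cases hi : x ∈ Ioo (a' i) (b' i) <;> simp [hi]
    simp [Fintype.sum_sum_type, hneg, hx]

/-! ### Jumps across horizontal lines -/

open Classical in
/-- The indicator of "all points vertically close to `(x, t)` lie in `S`", where only points
above are considered if `σ = 1` and only points below if `σ = -1`. -/
noncomputable def germ (σ : ℝ) (S : Set (ℝ × ℝ)) (t x : ℝ) : ℝ :=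
  if ∀ᶠ δ in 𝓝[>] (0 : ℝ), (x, t + σ * δ) ∈ S then 1 else 0

/-- The jump of the indicator function of `S` when the horizontal line at height `t` is crossed
upwards at abscissa `x`. -/
noncomputable def jump (S : Set (ℝ × ℝ)) (t x : ℝ) : ℝ := germ 1 S t x - germ (-1) S t x

/-- Vertically close to `(x, t)`, on each of the two sides, the points lie all in the interior of
`S` or all outside `S`. -/
def Decided (S : Set (ℝ × ℝ)) (t x : ℝ) : Prop :=
  ∀ σ : ℝ, σ = 1 ∨ σ = -1 → (∀ᶠ δ in 𝓝[>] (0 : ℝ), (x, t + σ * δ) ∈ interior S) ∨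
    ∀ᶠ δ in 𝓝[>] (0 : ℝ), (x, t + σ * δ) ∉ S

theorem germ_of_eventually_mem {σ : ℝ} {S : Set (ℝ × ℝ)} {t x : ℝ}
    (h : ∀ᶠ δ in 𝓝[>] (0 : ℝ), (x, t + σ * δ) ∈ S) : germ σ S t x = 1 := if_pos h

theorem germ_of_eventually_notMem {σ : ℝ} {S : Set (ℝ × ℝ)} {t x : ℝ}
    (h : ∀ᶠ δ in 𝓝[>] (0 : ℝ), (x, t + σ * δ) ∉ S) : germ σ S t x = 0 := by
  refine if_neg fun h' => ?_
  obtain ⟨δ, h1, h2⟩ := (h.and h').exists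
  exact h1 h2

theorem tendsto_vertical (σ t x : ℝ) :
    Tendsto (fun δ : ℝ => (x, t + σ * δ)) (𝓝[>] 0) (𝓝 (x, t)) := by
  have : Continuous fun δ : ℝ => (x, t + σ * δ) := by fun_prop
  simpa using (this.tendsto 0).mono_left nhdsWithin_le_nhds

theorem decided_of_notMem_frontier {S : Set (ℝ × ℝ)} {t x : ℝ} (h : (x, t) ∉ frontier S) :
    Decided S t x := by
  intro σ _
  by_cases hx : (x, t) ∈ interior S
  · exact Or.inl ((tendsto_vertical σ t x).eventually (isOpen_interior.mem_nhds hx))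
  · have hc : (x, t) ∈ (closure S)ᶜ := fun hc => h ⟨hc, hx⟩
    refine Or.inr ?_
    filter_upwards [(tendsto_vertical σ t x).eventually (isClosed_closure.isOpen_compl.mem_nhds hc)]
      with δ hδ hmem using hδ (subset_closure hmem)

theorem jump_of_notMem_frontier {S : Set (ℝ × ℝ)} {t x : ℝ} (h : (x, t) ∉ frontier S) :
    jump S t x = 0 := by
  by_cases hx : (x, t) ∈ interior S
  · have : ∀ σ, germ σ S t x = 1 := fun σ => germ_of_eventually_mem <|
      ((tendsto_vertical σ t x).eventually (isOpen_interior.mem_nhds hx)).mono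
        fun δ hδ => interior_subset hδ
    simp [jump, this]
  · have hc : (x, t) ∈ (closure S)ᶜ := fun hc => h ⟨hc, hx⟩
    have : ∀ σ, germ σ S t x = 0 := fun σ => germ_of_eventually_notMem <|
      ((tendsto_vertical σ t x).eventually
        (isClosed_closure.isOpen_compl.mem_nhds hc)).mono fun δ hδ hmem => hδ (subset_closure hmem)
    simp [jump, this]

theorem germ_iUnion {ι : Type*} [Fintype ι] {R : ι → Set (ℝ × ℝ)} {σ t x : ℝ}
    (hσ : σ = 1 ∨ σ = -1)
    (hdisj : ∀ i j, i ≠ j → Disjoint (interior (R i)) (interior (R j)))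
    (hdec : ∀ i, Decided (R i) t x) : germ σ (⋃ i, R i) t x = ∑ i, germ σ (R i) t x := by
  classical
  by_cases h : ∃ i, ∀ᶠ δ in 𝓝[>] (0 : ℝ), (x, t + σ * δ) ∈ interior (R i)
  · obtain ⟨i, hi⟩ := h
    rw [Finset.sum_eq_single i]
    · rw [germ_of_eventually_mem (hi.mono fun δ hδ => interior_subset hδ),
        germ_of_eventually_mem (hi.mono fun δ hδ => mem_iUnion.2 ⟨i, interior_subset hδ⟩)]
    · intro j _ hj
      refine germ_of_eventually_notMem ((hdec j σ hσ).resolve_left fun hj' => ?_)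
      obtain ⟨δ, h1, h2⟩ := (hi.and hj').exists
      exact disjoint_left.1 (hdisj i j hj.symm) h1 h2
    · simp
  · have hout : ∀ i, ∀ᶠ δ in 𝓝[>] (0 : ℝ), (x, t + σ * δ) ∉ R i :=
      fun i => (hdec i σ hσ).resolve_left fun hi => h ⟨i, hi⟩
    rw [germ_of_eventually_notMem, Finset.sum_eq_zero fun i _ => germ_of_eventually_notMem (hout i)]
    filter_upwards [eventually_all.2 hout] with δ hδ
    simpa using hδ

theorem jump_iUnion {ι : Type*} [Fintype ι] {R : ι → Set (ℝ × ℝ)} {t x : ℝ}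
    (hdisj : ∀ i j, i ≠ j → Disjoint (interior (R i)) (interior (R j)))
    (hdec : ∀ i, Decided (R i) t x) : jump (⋃ i, R i) t x = ∑ i, jump (R i) t x := by
  simp only [jump, germ_iUnion (.inl rfl) hdisj hdec, germ_iUnion (.inr rfl) hdisj hdec,
    Finset.sum_sub_distrib]

/-- The horizontal sides of `S` have the abscissas `x₀ ≤ x₁` as endpoints, the lower one being at
height `y₀` and the upper one at height `y₁`: at almost every abscissa, the jump of `S` across each
horizontal line is the one caused by these two sides. If `x₀ = x₁` then `S` has no horizontal
sides at all. -/
structure HasSides (S : Set (ℝ × ℝ)) (x₀ x₁ y₀ y₁ : ℝ) : Prop where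
  le : x₀ ≤ x₁
  decided : ∀ t, ∀ᵐ x, Decided S t x
  jump_eq : ∀ t, ∀ᵐ x, jump S t x = (Ioo x₀ x₁).indicator
    (fun _ => (if t = y₀ then 1 else 0) - (if t = y₁ then 1 else 0)) x

theorem hasSides_Icc_prod {x₀ x₁ y₀ y₁ : ℝ} (hx : x₀ < x₁) (hy : y₀ < y₁) :
    HasSides (Icc x₀ x₁ ×ˢ Icc y₀ y₁) x₀ x₁ y₀ y₁ := by
  have hint : interior (Icc x₀ x₁ ×ˢ Icc y₀ y₁) = Ioo x₀ x₁ ×ˢ Ioo y₀ y₁ := by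
    rw [interior_prod_eq, interior_Icc, interior_Icc]
  have hout : ∀ {x t σ : ℝ}, x ∉ Icc x₀ x₁ →
      ∀ᶠ δ in 𝓝[>] (0 : ℝ), (x, t + σ * δ) ∉ Icc x₀ x₁ ×ˢ Icc y₀ y₁ :=
    fun h => Eventually.of_forall fun δ hδ => h hδ.1
  have hlim : ∀ σ t : ℝ, Tendsto (fun δ : ℝ => t + σ * δ) (𝓝[>] 0) (𝓝 t) := fun σ t => by
    have : Continuous fun δ : ℝ => t + σ * δ := by fun_prop
    simpa using (this.tendsto 0).mono_left nhdsWithin_le_nhds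
  have hpos : ∀ᶠ δ in 𝓝[>] (0 : ℝ), 0 < δ := self_mem_nhdsWithin
  have hup : ∀ t : ℝ, y₀ ≤ t → t < y₁ → ∀ᶠ δ in 𝓝[>] (0 : ℝ), t + 1 * δ ∈ Ioo y₀ y₁ := by
    intro t h0 h1
    filter_upwards [hpos, (hlim 1 t).eventually (gt_mem_nhds h1)] with δ hδ hlt
    exact ⟨by linarith, hlt⟩
  have hdown : ∀ t : ℝ, y₀ < t → t ≤ y₁ → ∀ᶠ δ in 𝓝[>] (0 : ℝ), t + -1 * δ ∈ Ioo y₀ y₁ := by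
    intro t h0 h1
    filter_upwards [hpos, (hlim (-1) t).eventually (lt_mem_nhds h0)] with δ hδ hlt
    exact ⟨hlt, by linarith⟩
  have hup' : ∀ t : ℝ, ¬(y₀ ≤ t ∧ t < y₁) → ∀ᶠ δ in 𝓝[>] (0 : ℝ), t + 1 * δ ∉ Icc y₀ y₁ := by
    intro t ht
    by_cases h0 : t < y₀
    · filter_upwards [(hlim 1 t).eventually (gt_mem_nhds h0)] with δ hδ h using not_le.2 hδ h.1
    · have h1 : y₁ ≤ t := by by_contra h1; exact ht ⟨not_lt.1 h0, not_le.1 h1⟩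
      filter_upwards [hpos] with δ hδ h
      linarith [h.2]
  have hdown' : ∀ t : ℝ, ¬(y₀ < t ∧ t ≤ y₁) →
      ∀ᶠ δ in 𝓝[>] (0 : ℝ), t + -1 * δ ∉ Icc y₀ y₁ := by
    intro t ht
    by_cases h1 : y₁ < t
    · filter_upwards [(hlim (-1) t).eventually (lt_mem_nhds h1)] with δ hδ h using not_le.2 hδ h.2
    · have h0 : t ≤ y₀ := by by_contra h0; exact ht ⟨not_le.1 h0, not_lt.1 h1⟩
      filter_upwards [hpos] with δ hδ h
      linarith [h.1]
  have hne : ∀ c : ℝ, ∀ᵐ x : ℝ, x ≠ c := fun c => by simp [ae_iff]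
  refine ⟨hx.le, fun t => ?_, fun t => ?_⟩
  · filter_upwards [hne x₀, hne x₁] with x h0 h1
    by_cases hxI : x ∈ Icc x₀ x₁
    · have hxo : x ∈ Ioo x₀ x₁ := ⟨hxI.1.lt_of_ne h0.symm, hxI.2.lt_of_ne h1⟩
      rw [Decided, hint]
      rintro σ (rfl | rfl)
      · by_cases ht : y₀ ≤ t ∧ t < y₁
        · exact Or.inl ((hup t ht.1 ht.2).mono fun δ hδ => ⟨hxo, hδ⟩)
        · exact Or.inr ((hup' t ht).mono fun δ hδ h => hδ h.2)
      · by_cases ht : y₀ < t ∧ t ≤ y₁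
        · exact Or.inl ((hdown t ht.1 ht.2).mono fun δ hδ => ⟨hxo, hδ⟩)
        · exact Or.inr ((hdown' t ht).mono fun δ hδ h => hδ h.2)
    · exact fun σ _ => Or.inr (hout hxI)
  · filter_upwards [hne x₀, hne x₁] with x h0 h1
    by_cases hxI : x ∈ Icc x₀ x₁
    · have hxo : x ∈ Ioo x₀ x₁ := ⟨hxI.1.lt_of_ne h0.symm, hxI.2.lt_of_ne h1⟩
      have e1 : germ 1 (Icc x₀ x₁ ×ˢ Icc y₀ y₁) t x = if y₀ ≤ t ∧ t < y₁ then 1 else 0 := by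
        split_ifs with ht
        · exact germ_of_eventually_mem
            ((hup t ht.1 ht.2).mono fun δ hδ => ⟨hxI, Ioo_subset_Icc_self hδ⟩)
        · exact germ_of_eventually_notMem ((hup' t ht).mono fun δ hδ h => hδ h.2)
      have e2 : germ (-1) (Icc x₀ x₁ ×ˢ Icc y₀ y₁) t x = if y₀ < t ∧ t ≤ y₁ then 1 else 0 := by
        split_ifs with ht
        · exact germ_of_eventually_mem
            ((hdown t ht.1 ht.2).mono fun δ hδ => ⟨hxI, Ioo_subset_Icc_self hδ⟩)
        · exact germ_of_eventually_notMem ((hdown' t ht).mono fun δ hδ h => hδ h.2)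
      rw [jump, e1, e2, indicator_of_mem hxo]
      rcases lt_trichotomy t y₀ with h | h | h <;> rcases lt_trichotomy t y₁ with h' | h' | h' <;>
        grind
    · rw [indicator_of_notMem fun h => hxI (Ioo_subset_Icc_self h), jump,
        germ_of_eventually_notMem (hout hxI), germ_of_eventually_notMem (hout hxI), sub_self]

theorem hasSides_of_ae_notMem_frontier {S : Set (ℝ × ℝ)}
    (h : ∀ t, ∀ᵐ x : ℝ, (x, t) ∉ frontier S) : HasSides S 0 0 0 0 :=
  ⟨le_rfl, fun t => (h t).mono fun _ => decided_of_notMem_frontier,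
    fun t => (h t).mono fun x hx => by simp [jump_of_notMem_frontier hx]⟩

/-- A rectangle none of whose sides is horizontal has no horizontal sides. -/
theorem hasSides_tilted {O u v : ℝ × ℝ} (hu : u.2 ≠ 0) (hv : v.2 ≠ 0)
    (hdet : u.1 * v.2 - u.2 * v.1 ≠ 0) :
    HasSides {z | ∃ s ∈ Icc (0 : ℝ) 1, ∃ t ∈ Icc (0 : ℝ) 1, z = O + s • u + t • v} 0 0 0 0 := by
  set D := u.1 * v.2 - u.2 * v.1 with hD
  -- the coordinates with respect to the origin `O` and the basis `u`, `v`
  let s : ℝ × ℝ → ℝ := fun z => ((z.1 - O.1) * v.2 - (z.2 - O.2) * v.1) / D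
  let t : ℝ × ℝ → ℝ := fun z => ((z.2 - O.2) * u.1 - (z.1 - O.1) * u.2) / D
  have hs : Continuous s := by fun_prop
  have ht : Continuous t := by fun_prop
  have hS : {z | ∃ s ∈ Icc (0 : ℝ) 1, ∃ t ∈ Icc (0 : ℝ) 1, z = O + s • u + t • v}
      = s ⁻¹' Icc 0 1 ∩ t ⁻¹' Icc 0 1 := by
    ext z
    constructor
    · rintro ⟨a, ha, b, hb, rfl⟩
      have h1 : s (O + a • u + b • v) = a := by
        simp only [s, Prod.fst_add, Prod.snd_add, Prod.smul_fst, Prod.smul_snd, smul_eq_mul]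
        field_simp; rw [hD]; ring
      have h2 : t (O + a • u + b • v) = b := by
        simp only [t, Prod.fst_add, Prod.snd_add, Prod.smul_fst, Prod.smul_snd, smul_eq_mul]
        field_simp; rw [hD]; ring
      exact ⟨by rwa [mem_preimage, h1], by rwa [mem_preimage, h2]⟩
    · rintro ⟨h1, h2⟩
      refine ⟨s z, h1, t z, h2, ?_⟩
      ext
      · simp only [s, t, Prod.fst_add, Prod.smul_fst, smul_eq_mul]
        field_simp; rw [hD]; ring
      · simp only [s, t, Prod.snd_add, Prod.smul_snd, smul_eq_mul]
        field_simp; rw [hD]; ring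
  rw [hS]
  refine hasSides_of_ae_notMem_frontier fun y => ?_
  have hfr : frontier (s ⁻¹' Icc 0 1 ∩ t ⁻¹' Icc 0 1) ⊆ s ⁻¹' {0, 1} ∪ t ⁻¹' {0, 1} := by
    refine (frontier_inter_subset _ _).trans (union_subset_union ?_ ?_)
    · refine inter_subset_left.trans ((hs.frontier_preimage_subset _).trans ?_)
      rw [frontier_Icc zero_le_one]
    · refine inter_subset_right.trans ((ht.frontier_preimage_subset _).trans ?_)
      rw [frontier_Icc zero_le_one]
  have hne : ∀ c : ℝ, ∀ᵐ x : ℝ, x ≠ c := fun c => by simp [ae_iff]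
  -- each of the lines `s = 0`, `s = 1`, `t = 0`, `t = 1` meets the height `y` in one point
  filter_upwards [hne (O.1 + (y - O.2) * v.1 / v.2), hne (O.1 + (D + (y - O.2) * v.1) / v.2),
    hne (O.1 + (y - O.2) * u.1 / u.2), hne (O.1 + ((y - O.2) * u.1 - D) / u.2)]
    with x h1 h2 h3 h4 hx
  rcases hfr hx with (h | h) | (h | h)
  · refine h1 ?_
    simp only [s, div_eq_zero_iff, hdet, or_false] at h
    field_simp; linarith
  · refine h2 ?_
    simp only [s, mem_singleton_iff, div_eq_one_iff_eq hdet] at h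
    field_simp; linarith
  · refine h3 ?_
    simp only [t, div_eq_zero_iff, hdet, or_false] at h
    field_simp; linarith
  · refine h4 ?_
    simp only [t, mem_singleton_iff, div_eq_one_iff_eq hdet] at h
    field_simp; linarith

/-! ### The additive invariant of a dissection -/

/-- Summation of the jumps over all heights `t`, weighted by `g t`, turns the jumps at the two
horizontal sides into the increment of `g` over the height. -/
theorem sum_jump_mul_eq {ι : Type*} [Fintype ι] (F y₀ y₁ : ι → ℝ) (g : ℝ → ℝ) (T : Finset ℝ)
    (h₀ : ∀ i, y₀ i ∈ T) (h₁ : ∀ i, y₁ i ∈ T) :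
    ∑ t ∈ T, g t * ∑ i, ((if t = y₀ i then 1 else 0) - (if t = y₁ i then 1 else 0)) * F i
      = -∑ i, F i * (g (y₁ i) - g (y₀ i)) := by
  simp only [Finset.mul_sum]
  rw [Finset.sum_comm, ← Finset.sum_neg_distrib]
  refine Finset.sum_congr rfl fun i _ => ?_
  have : ∀ t, g t * (((if t = y₀ i then 1 else 0) - (if t = y₁ i then 1 else 0)) * F i)
      = (if t = y₀ i then g t * F i else 0) - (if t = y₁ i then g t * F i else 0) := by
    intro t; split_ifs <;> ring
  simp only [this, Finset.sum_sub_distrib, Finset.sum_ite_eq', h₀, h₁, if_true]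
  ring

theorem jump_iUnion_ae {ι : Type*} [Fintype ι] {R : ι → Set (ℝ × ℝ)} {x₀ x₁ y₀ y₁ : ι → ℝ}
    (hdisj : ∀ i j, i ≠ j → Disjoint (interior (R i)) (interior (R j)))
    (hR : ∀ i, HasSides (R i) (x₀ i) (x₁ i) (y₀ i) (y₁ i)) (t : ℝ) :
    ∀ᵐ x, jump (⋃ i, R i) t x = ∑ i, (Ioo (x₀ i) (x₁ i)).indicator
      (fun _ => (if t = y₀ i then 1 else 0) - (if t = y₁ i then 1 else 0)) x := by
  filter_upwards [eventually_all.2 fun i => (hR i).decided t,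
    eventually_all.2 fun i => (hR i).jump_eq t] with x hd hj
  rw [jump_iUnion hdisj hd]
  exact Finset.sum_congr rfl fun i _ => hj i

/-- Two dissections of the same set have equal sums of products of the increments of `f` over the
width and of `g` over the height, because both compute the jumps of that set. -/
theorem sum_sub_mul_sub_eq_of_iUnion_eq {ι ι' : Type*} [Fintype ι] [Fintype ι']
    {R : ι → Set (ℝ × ℝ)} {R' : ι' → Set (ℝ × ℝ)} {x₀ x₁ y₀ y₁ : ι → ℝ} {x₀' x₁' y₀' y₁' : ι' → ℝ}
    (hdisj : ∀ i j, i ≠ j → Disjoint (interior (R i)) (interior (R j)))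
    (hdisj' : ∀ i j, i ≠ j → Disjoint (interior (R' i)) (interior (R' j)))
    (hR : ∀ i, HasSides (R i) (x₀ i) (x₁ i) (y₀ i) (y₁ i))
    (hR' : ∀ i, HasSides (R' i) (x₀' i) (x₁' i) (y₀' i) (y₁' i))
    (hU : ⋃ i, R i = ⋃ i, R' i) (f g : ℝ → ℝ) :
    ∑ i, (f (x₁ i) - f (x₀ i)) * (g (y₁ i) - g (y₀ i))
      = ∑ i, (f (x₁' i) - f (x₀' i)) * (g (y₁' i) - g (y₀' i)) := by
  classical
  let T : Finset ℝ := Finset.univ.image y₀ ∪ Finset.univ.image y₁ ∪ Finset.univ.image y₀' ∪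
    Finset.univ.image y₁'
  have h1 := sum_jump_mul_eq (fun i => f (x₁ i) - f (x₀ i)) y₀ y₁ g T (by simp [T]) (by simp [T])
  have h2 := sum_jump_mul_eq (fun i => f (x₁' i) - f (x₀' i)) y₀' y₁' g T
    (by simp [T]) (by simp [T])
  rw [← neg_inj, ← h1, ← h2]
  refine Finset.sum_congr rfl fun t _ => congrArg _ ?_
  refine sum_mul_sub_eq_of_ae (fun i => (hR i).le) (fun i => (hR' i).le) ?_ f
  filter_upwards [jump_iUnion_ae hdisj hR t, jump_iUnion_ae hdisj' hR' t] with x e1 e2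
  rw [← e1, ← e2, hU]

/-- The jump across a horizontal line is constant along a piece of this line which locally contains
the whole frontier. -/
theorem jump_eqOn_Ioo {M C : Set (ℝ × ℝ)} {t a b : ℝ} (hC : IsClosed C)
    (hfr : ∀ z ∈ frontier M, z ∈ C ∨ z.2 = t) (hab : ∀ x ∈ Ioo a b, (x, t) ∉ C)
    {x x' : ℝ} (hx : x ∈ Ioo a b) (hx' : x' ∈ Ioo a b) : jump M t x = jump M t x' := by
  have key : ∀ σ : ℝ, σ ≠ 0 → ∀ x ∈ Ioo a b, ∀ x' ∈ Ioo a b, germ σ M t x = germ σ M t x' := by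
    intro σ hσ x hx x' hx'
    have hloc : ∀ x ∈ Ioo a b, ∀ᶠ x' in 𝓝 x, germ σ M t x' = germ σ M t x := by
      intro x hx
      obtain ⟨η, hη, hball⟩ := Metric.isOpen_iff.1 hC.isOpen_compl (x, t) (hab x hx)
      have hη' : 0 < η / |σ| := by positivity
      -- a box attached to the line from one side, which does not meet the frontier
      set H : Set (ℝ × ℝ) :=
        (fun z : ℝ × ℝ => (z.1, t + σ * z.2)) '' Metric.ball x η ×ˢ Ioo 0 (η / |σ|) with hH
      have hHpre : IsPreconnected H :=
        ((convex_ball x η).prod (convex_Ioo _ _)).isPreconnected.image _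
          (by fun_prop : Continuous fun z : ℝ × ℝ => (z.1, t + σ * z.2)).continuousOn
      have hHfr : H ∩ frontier M = ∅ := by
        rw [eq_empty_iff_forall_notMem]
        rintro _ ⟨⟨⟨w, δ⟩, ⟨hw, hδ⟩, rfl⟩, hmem⟩
        rcases hfr _ hmem with h | h
        · refine hball ?_ h
          rw [← ball_prod_same]
          refine ⟨hw, ?_⟩
          have : |σ| * δ < η := by
            have := (lt_div_iff₀ (abs_pos.2 hσ)).1 hδ.2
            linarith
          simpa [Real.dist_eq, abs_mul, abs_of_pos hδ.1] using this
        · have : σ * δ = 0 := by simpa using h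
          exact (mul_ne_zero hσ hδ.1.ne') this
      have hδev : ∀ᶠ δ in 𝓝[>] (0 : ℝ), δ ∈ Ioo 0 (η / |σ|) := Ioo_mem_nhdsGT hη'
      have hmemH : ∀ x' ∈ Metric.ball x η, ∀ᶠ δ in 𝓝[>] (0 : ℝ), (x', t + σ * δ) ∈ H :=
        fun x' hx' => hδev.mono fun δ hδ => ⟨(x', δ), ⟨hx', hδ⟩, rfl⟩
      have hcases : H ⊆ M ∨ H ⊆ Mᶜ := by
        by_contra! hcon
        obtain ⟨⟨z, hz, hzM⟩, ⟨w, hw, hwM⟩⟩ := And.imp not_subset.1 not_subset.1 hcon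
        obtain ⟨y, -, hy1, hy2⟩ := hHpre (interior M) (closure M)ᶜ isOpen_interior
          isClosed_closure.isOpen_compl
          (fun y hy => by
            by_contra hy'
            rw [mem_union, not_or] at hy'
            exact (hHfr.le ⟨hy, not_not.1 hy'.2, hy'.1⟩).elim)
          ⟨w, hw, by
            by_contra hw'
            exact (hHfr.le ⟨hw, subset_closure (not_not.1 hwM), hw'⟩).elim⟩
          ⟨z, hz, fun hz' => (hHfr.le ⟨hz, hz', fun h => hzM (interior_subset h)⟩).elim⟩
        exact hy2 (subset_closure (interior_subset hy1))
      filter_upwards [Metric.ball_mem_nhds x hη] with x' hx'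
      rcases hcases with h | h
      · rw [germ_of_eventually_mem ((hmemH x' hx').mono fun δ hδ => h hδ),
          germ_of_eventually_mem ((hmemH x (Metric.mem_ball_self hη)).mono fun δ hδ => h hδ)]
      · rw [germ_of_eventually_notMem ((hmemH x' hx').mono fun δ hδ => h hδ),
          germ_of_eventually_notMem ((hmemH x (Metric.mem_ball_self hη)).mono fun δ hδ => h hδ)]
    refine isPreconnected_Ioo.constant_of_mapsTo (T := {0, 1}) (f := germ σ M t)
      (Set.toFinite _).isDiscrete (fun x hx => ?_) (fun x _ => ?_) hx hx'
    · exact (continuousAt_const.congr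
        ((hloc x hx).mono fun _ h => h.symm)).continuousWithinAt
    · by_cases h : ∀ᶠ δ in 𝓝[>] (0 : ℝ), (x, t + σ * δ) ∈ M <;> simp [germ, h]
  rw [jump, jump, key 1 one_ne_zero x hx x' hx', key (-1) (neg_ne_zero.2 one_ne_zero) x hx x' hx']

/-! ### Frontiers made of segments -/

theorem mem_openSegment_of_horizontal {A B : ℝ × ℝ} {t x : ℝ} (hA : A.2 = t) (hB : B.2 = t)
    (hx : x ∈ Ioo (min A.1 B.1) (max A.1 B.1)) : (x, t) ∈ openSegment ℝ A B := by
  obtain ⟨a, _⟩ := A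
  obtain ⟨b, _⟩ := B
  obtain rfl : _ = t := hA
  obtain rfl : _ = _ := hB
  have hab : a ≠ b := by rintro rfl; simp at hx
  rw [← Prod.image_mk_openSegment_left, openSegment_eq_Ioo' hab]
  exact ⟨x, hx, rfl⟩

theorem ae_notMem_segment_or {A B : ℝ × ℝ} (t : ℝ) : ∀ᵐ x : ℝ, (x, t) ∉ segment ℝ A B ∨
    (A.2 = t ∧ B.2 = t ∧ x ∈ Ioo (min A.1 B.1) (max A.1 B.1)) := by
  have hne : ∀ c : ℝ, ∀ᵐ x : ℝ, x ≠ c := fun c => by simp [ae_iff]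
  by_cases h : A.2 = B.2
  · filter_upwards [hne A.1, hne B.1] with x h1 h2
    refine or_iff_not_imp_left.2 fun hx => ?_
    obtain ⟨a, c⟩ := A
    obtain ⟨b, c'⟩ := B
    obtain rfl : c = c' := h
    rw [not_not, ← Prod.image_mk_segment_left, segment_eq_uIcc] at hx
    obtain ⟨y, hy, hxy⟩ := hx
    rw [Prod.mk.injEq] at hxy
    obtain ⟨rfl, rfl⟩ := hxy
    refine ⟨rfl, rfl, hy.1.lt_of_ne ?_, hy.2.lt_of_ne ?_⟩
    · rcases min_choice a b with h | h <;> rw [h]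
      exacts [h1.symm, h2.symm]
    · rcases max_choice a b with h | h <;> rw [h]
      exacts [h1, h2]
  · have hsub : B.2 - A.2 ≠ 0 := sub_ne_zero.2 (Ne.symm h)
    filter_upwards [hne (A.1 + (t - A.2) / (B.2 - A.2) * (B.1 - A.1))] with x hx
    refine Or.inl fun hmem => hx ?_
    rw [segment_eq_image'] at hmem
    obtain ⟨s, -, hs⟩ := hmem
    have h1 : A.1 + s * (B.1 - A.1) = x := congrArg Prod.fst hs
    have h2 : A.2 + s * (B.2 - A.2) = t := congrArg Prod.snd hs
    have : (t - A.2) / (B.2 - A.2) = s := by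
      rw [div_eq_iff hsub]; linarith
    rw [this, h1]

/-- If no open segment of the frontier meets another one, the jump across a horizontal line is
almost everywhere a combination of the indicator functions of the horizontal frontier segments. -/
theorem jump_eq_sum_of_frontier {E : Type*} [Fintype E] {M : Set (ℝ × ℝ)} {A B : E → ℝ × ℝ}
    (hfr : frontier M = ⋃ e, segment ℝ (A e) (B e))
    (hdisj : ∀ e e', e ≠ e' → Disjoint (openSegment ℝ (A e) (B e)) (segment ℝ (A e') (B e')))
    (t : ℝ) : ∃ κ : E → ℝ, (∀ e, κ e ≠ 0 → (A e).2 = (B e).2) ∧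
      ∀ᵐ x, jump M t x = ∑ e, (Ioo (min (A e).1 (B e).1) (max (A e).1 (B e).1)).indicator
        (fun _ => κ e) x := by
  classical
  set I : E → Set ℝ := fun e => Ioo (min (A e).1 (B e).1) (max (A e).1 (B e).1) with hI
  have hconst : ∀ e, (A e).2 = t → (B e).2 = t → ∀ x ∈ I e, ∀ x' ∈ I e,
      jump M t x = jump M t x' := by
    intro e hA hB x hx x' hx'
    refine jump_eqOn_Ioo (C := ⋃ e' ∈ {e' | e' ≠ e}, segment ℝ (A e') (B e')) ?_ ?_ ?_ hx hx'
    · refine (toFinite _).isClosed_biUnion fun e' _ => ?_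
      rw [← convexHull_pair]
      exact (Set.Finite.isCompact_convexHull ℝ (toFinite _)).isClosed
    · intro z hz
      rw [hfr, mem_iUnion] at hz
      obtain ⟨e', hz⟩ := hz
      by_cases he : e' = e
      · right
        subst he
        rw [segment_eq_image'] at hz
        obtain ⟨s, -, rfl⟩ := hz
        simp [hA, hB]
      · exact Or.inl (mem_biUnion (show e' ∈ {e' | e' ≠ e} from he) hz)
    · intro x hx hmem
      rw [mem_iUnion₂] at hmem
      obtain ⟨e', he', hmem⟩ := hmem
      exact disjoint_left.1 (hdisj e e' (Ne.symm he'))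
        (mem_openSegment_of_horizontal hA hB hx) hmem
  refine ⟨fun e => if (A e).2 = t ∧ (B e).2 = t then jump M t (((A e).1 + (B e).1) / 2) else 0,
    fun e he => ?_, ?_⟩
  · have := (ite_ne_right_iff.1 he).1
    rw [this.1, this.2]
  · filter_upwards [eventually_all.2 fun e => ae_notMem_segment_or (A := A e) (B := B e) t] with x hx
    by_cases h : ∃ e, (A e).2 = t ∧ (B e).2 = t ∧ x ∈ I e
    · obtain ⟨e, hA, hB, hxe⟩ := h
      rw [Finset.sum_eq_single e]
      · rw [indicator_of_mem hxe, if_pos ⟨hA, hB⟩]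
        refine hconst e hA hB x hxe _ ?_
        have hlt := hxe.1.trans hxe.2
        have hs := min_add_max (A e).1 (B e).1
        constructor <;> linarith
      · intro e' _ he'
        by_cases hx' : x ∈ I e'
        · rw [indicator_of_mem hx', if_neg]
          rintro ⟨hA', hB'⟩
          exact disjoint_left.1 (hdisj e e' he'.symm) (mem_openSegment_of_horizontal hA hB hxe)
            (openSegment_subset_segment _ _ _ (mem_openSegment_of_horizontal hA' hB' hx'))
        · rw [indicator_of_notMem hx']
      · simp
    · have hout : (x, t) ∉ frontier M := by
        rw [hfr, mem_iUnion]
        rintro ⟨e, he⟩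
        exact h ⟨e, (hx e).resolve_left (not_not.2 he)⟩
      rw [jump_of_notMem_frontier hout, Finset.sum_eq_zero]
      intro e _
      by_cases hxe : x ∈ I e
      · rw [indicator_of_mem hxe, if_neg fun h' => h ⟨e, h'.1, h'.2, hxe⟩]
      · rw [indicator_of_notMem hxe]

theorem sum_sub_mul_sub_eq_zero_of_frontier {ι E : Type*} [Fintype ι] [Fintype E]
    {R : ι → Set (ℝ × ℝ)} {x₀ x₁ y₀ y₁ : ι → ℝ} {A B : E → ℝ × ℝ}
    (hdisj : ∀ i j, i ≠ j → Disjoint (interior (R i)) (interior (R j)))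
    (hR : ∀ i, HasSides (R i) (x₀ i) (x₁ i) (y₀ i) (y₁ i))
    (hfr : frontier (⋃ i, R i) = ⋃ e, segment ℝ (A e) (B e))
    (hAB : ∀ e e', e ≠ e' → Disjoint (openSegment ℝ (A e) (B e)) (segment ℝ (A e') (B e')))
    {f : ℝ → ℝ} (hf : ∀ e, (A e).2 = (B e).2 → f (A e).1 = f (B e).1) (g : ℝ → ℝ) :
    ∑ i, (f (x₁ i) - f (x₀ i)) * (g (y₁ i) - g (y₀ i)) = 0 := by
  classical
  let T : Finset ℝ := Finset.univ.image y₀ ∪ Finset.univ.image y₁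
  have h1 := sum_jump_mul_eq (fun i => f (x₁ i) - f (x₀ i)) y₀ y₁ g T (by simp [T]) (by simp [T])
  rw [← neg_eq_zero, ← h1]
  refine Finset.sum_eq_zero fun t _ => ?_
  obtain ⟨κ, hκ, hjump⟩ := jump_eq_sum_of_frontier hfr hAB t
  rw [sum_mul_sub_eq_of_ae (fun i => (hR i).le) (fun e => min_le_max (a := (A e).1) (b := (B e).1))
    (by filter_upwards [jump_iUnion_ae hdisj hR t, hjump] with x e1 e2; rw [← e1, e2]) f,
    Finset.sum_eq_zero, mul_zero]
  intro e _
  by_cases hκe : κ e = 0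
  · rw [hκe, zero_mul]
  · have := hf e (hκ e hκe)
    rcases le_total (A e).1 (B e).1 with h | h <;> simp [h, this]

/-! ### Orthonormal frames and rectangles -/

/-- `Ψ` is the coordinate map of an orthonormal frame of the plane. -/
def IsFrame (Ψ : Plane ≃L[ℝ] ℝ × ℝ) : Prop :=
  ∀ z w : Plane, inner ℝ z w = (Ψ z).1 * (Ψ w).1 + (Ψ z).2 * (Ψ w).2

theorem exists_isFrame {u v : Plane} (hu : u ≠ 0) (hv : v ≠ 0) (huv : inner ℝ u v = 0) :
    ∃ Ψ : Plane ≃L[ℝ] ℝ × ℝ, IsFrame Ψ ∧ (Ψ u).2 = 0 := by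
  have hu' : ‖u‖ ≠ 0 := norm_ne_zero_iff.2 hu
  have hv' : ‖v‖ ≠ 0 := norm_ne_zero_iff.2 hv
  have hon : Orthonormal ℝ ![‖u‖⁻¹ • u, ‖v‖⁻¹ • v] := by
    have h1 : ‖‖u‖⁻¹ • u‖ = 1 := norm_smul_inv_norm hu
    have h2 : ‖‖v‖⁻¹ • v‖ = 1 := norm_smul_inv_norm hv
    have h3 : inner ℝ v u = 0 := by rw [real_inner_comm, huv]
    refine ⟨fun i => by fin_cases i <;> assumption, fun i j hij => ?_⟩
    fin_cases i <;> fin_cases j <;>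
      simp_all [inner_smul_left, inner_smul_right]
  obtain ⟨b, hb⟩ : ∃ b : OrthonormalBasis (Fin 2) ℝ Plane, ⇑b = ![‖u‖⁻¹ • u, ‖v‖⁻¹ • v] :=
    ⟨(basisOfOrthonormalOfCardEqFinrank hon (by simp)).toOrthonormalBasis (by simpa using hon),
      by simp⟩
  refine ⟨(b.repr.toContinuousLinearEquiv.trans (EuclideanSpace.equiv (Fin 2) ℝ)).trans
    (ContinuousLinearEquiv.finTwoArrow ℝ ℝ), fun z w => ?_, ?_⟩
  · rw [← b.repr.inner_map_map z w, PiLp.inner_apply, Fin.sum_univ_two]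
    change inner ℝ (b.repr z 0) (b.repr w 0) + inner ℝ (b.repr z 1) (b.repr w 1)
      = b.repr z 0 * b.repr w 0 + b.repr z 1 * b.repr w 1
    rw [Real.inner_apply, Real.inner_apply]
  · change b.repr u 1 = 0
    rw [b.repr_apply_apply, hb]
    simp [inner_smul_left, real_inner_comm, huv]

theorem IsFrame.norm_sq {Ψ : Plane ≃L[ℝ] ℝ × ℝ} (hΨ : IsFrame Ψ) (z : Plane) :
    ‖z‖ ^ 2 = (Ψ z).1 ^ 2 + (Ψ z).2 ^ 2 := by
  rw [← real_inner_self_eq_norm_sq, hΨ]; ring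

/-- The parallelogram with a vertex `O` and the side vectors `u`, `v`. -/
def parallelogram {V : Type*} [AddCommGroup V] [Module ℝ V] (O u v : V) : Set V :=
  {x | ∃ s ∈ Icc (0 : ℝ) 1, ∃ t ∈ Icc (0 : ℝ) 1, x = O + s • u + t • v}

theorem image_parallelogram {V W : Type*} [AddCommGroup V] [Module ℝ V] [AddCommGroup W]
    [Module ℝ W] (Ψ : V →ₗ[ℝ] W) (O u v : V) :
    Ψ '' parallelogram O u v = parallelogram (Ψ O) (Ψ u) (Ψ v) := by
  ext z
  constructor
  · rintro ⟨_, ⟨s, hs, t, ht, rfl⟩, rfl⟩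
    exact ⟨s, hs, t, ht, by simp⟩
  · rintro ⟨s, hs, t, ht, rfl⟩
    exact ⟨_, ⟨s, hs, t, ht, rfl⟩, by simp⟩

theorem parallelogram_comm {V : Type*} [AddCommGroup V] [Module ℝ V] (O u v : V) :
    parallelogram O u v = parallelogram O v u := by
  ext z
  constructor <;> rintro ⟨s, hs, t, ht, rfl⟩ <;> exact ⟨t, ht, s, hs, by abel⟩

theorem hasSides_aligned {O : ℝ × ℝ} {p q : ℝ} (hp : p ≠ 0) (hq : q ≠ 0) :
    ∃ x₀ x₁ y₀ y₁, HasSides (parallelogram O (p, 0) (0, q)) x₀ x₁ y₀ y₁ ∧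
      x₁ - x₀ = |p| ∧ y₁ - y₀ = |q| := by
  have h1 : ∀ a p z : ℝ, z ∈ uIcc a (a + p) ↔ ∃ s ∈ Icc (0 : ℝ) 1, z = a + s * p := by
    intro a p z
    rw [← segment_eq_uIcc, segment_eq_image']
    simp [eq_comm]
  have h2 : parallelogram O (p, 0) (0, q) = uIcc O.1 (O.1 + p) ×ˢ uIcc O.2 (O.2 + q) := by
    ext z
    rw [mem_prod, h1, h1]
    constructor
    · rintro ⟨s, hs, t, ht, rfl⟩
      exact ⟨⟨s, hs, by simp⟩, ⟨t, ht, by simp⟩⟩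
    · rintro ⟨⟨s, hs, h⟩, ⟨t, ht, h'⟩⟩
      exact ⟨s, hs, t, ht, by ext <;> simp [h, h']⟩
  have hlt : ∀ a p : ℝ, p ≠ 0 → min a (a + p) < max a (a + p) := by
    intro a p hp
    rw [min_lt_max]
    simpa using hp
  refine ⟨_, _, _, _, by rw [h2]; exact hasSides_Icc_prod (hlt _ _ hp) (hlt _ _ hq), ?_, ?_⟩ <;>
  · rw [max_sub_min_eq_abs]; simp

theorem exists_hasSides {Ψ : Plane ≃L[ℝ] ℝ × ℝ} (hΨ : IsFrame Ψ) {O u v : Plane} (hu : u ≠ 0)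
    (hv : v ≠ 0) (huv : inner ℝ u v = 0) :
    ∃ x₀ x₁ y₀ y₁, HasSides (Ψ '' parallelogram O u v) x₀ x₁ y₀ y₁ ∧
      (((Ψ u).2 = 0 ∧ x₁ - x₀ = ‖u‖ ∧ y₁ - y₀ = ‖v‖) ∨
        ((Ψ u).2 ≠ 0 ∧ x₁ - x₀ = ‖v‖ ∧ y₁ - y₀ = ‖u‖) ∨
        ((Ψ u).2 ≠ 0 ∧ x₁ - x₀ = 0 ∧ y₁ - y₀ = 0)) := by
  have himg : Ψ '' parallelogram O u v = parallelogram (Ψ O) (Ψ u) (Ψ v) :=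
    image_parallelogram (Ψ : Plane →ₗ[ℝ] ℝ × ℝ) O u v
  rw [himg]
  have hnu := hΨ.norm_sq u
  have hnv := hΨ.norm_sq v
  rw [hΨ] at huv
  have hu' : (Ψ u).1 ^ 2 + (Ψ u).2 ^ 2 ≠ 0 := by rw [← hnu]; simpa using hu
  have hv' : (Ψ v).1 ^ 2 + (Ψ v).2 ^ 2 ≠ 0 := by rw [← hnv]; simpa using hv
  have hnu' : ‖u‖ = √((Ψ u).1 ^ 2 + (Ψ u).2 ^ 2) := by rw [← hnu, Real.sqrt_sq (norm_nonneg _)]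
  have hnv' : ‖v‖ = √((Ψ v).1 ^ 2 + (Ψ v).2 ^ 2) := by rw [← hnv, Real.sqrt_sq (norm_nonneg _)]
  rw [hnu', hnv']
  generalize Ψ u = U at *
  generalize Ψ v = V at *
  obtain ⟨u₁, u₂⟩ := U
  obtain ⟨v₁, v₂⟩ := V
  dsimp only at *
  by_cases h2 : u₂ = 0
  · subst h2
    have hu1 : u₁ ≠ 0 := by rintro rfl; simp at hu'
    obtain rfl : v₁ = 0 := by simpa [hu1] using huv
    have hv2 : v₂ ≠ 0 := by rintro rfl; simp at hv'
    obtain ⟨x₀, x₁, y₀, y₁, h, hx, hy⟩ := hasSides_aligned (O := Ψ O) hu1 hv2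
    exact ⟨x₀, x₁, y₀, y₁, h, .inl ⟨rfl, by simp [hx, Real.sqrt_sq_eq_abs],
      by simp [hy, Real.sqrt_sq_eq_abs]⟩⟩
  · by_cases hv2 : v₂ = 0
    · subst hv2
      have hv1 : v₁ ≠ 0 := by rintro rfl; simp at hv'
      obtain rfl : u₁ = 0 := by simpa [hv1] using huv
      obtain ⟨x₀, x₁, y₀, y₁, h, hx, hy⟩ := hasSides_aligned (O := Ψ O) hv1 h2
      rw [parallelogram_comm] at h
      exact ⟨x₀, x₁, y₀, y₁, h, .inr (.inl ⟨h2, by simp [hx, Real.sqrt_sq_eq_abs],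
        by simp [hy, Real.sqrt_sq_eq_abs]⟩)⟩
    · refine ⟨0, 0, 0, 0, hasSides_tilted h2 hv2 ?_, .inr (.inr ⟨h2, by simp, by simp⟩)⟩
      intro hdet
      dsimp only at hdet
      have : (u₁ ^ 2 + u₂ ^ 2) * (v₁ ^ 2 + v₂ ^ 2) = 0 := by
        linear_combination (u₁ * v₁ + u₂ * v₂) * huv + (u₁ * v₂ - u₂ * v₁) * hdet
      exact mul_ne_zero hu' hv' this

/-- `B` is the additive invariant of `M` in the frame `Ψ`: for some dissection of `M` into pieces
with known horizontal sides, `B f g` is the sum of `f(width) * g(height)` over the pieces. -/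
def HasForm (Ψ : Plane ≃L[ℝ] ℝ × ℝ) (M : Set Plane)
    (B : (ℝ →ₗ[ℚ] ℝ) → (ℝ →ₗ[ℚ] ℝ) → ℝ) : Prop :=
  ∃ (N : ℕ) (R : Fin N → Set Plane) (x₀ x₁ y₀ y₁ : Fin N → ℝ), IsDissection M R ∧
    (∀ i, HasSides (Ψ '' R i) (x₀ i) (x₁ i) (y₀ i) (y₁ i)) ∧
    ∀ f g, B f g = ∑ i, f (x₁ i - x₀ i) * g (y₁ i - y₀ i)

theorem IsDissection.disjoint_interior_image {M : Set Plane} {N : ℕ} {R : Fin N → Set Plane}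
    (h : IsDissection M R) (Ψ : Plane ≃L[ℝ] ℝ × ℝ) (i j : Fin N) (hij : i ≠ j) :
    Disjoint (interior (Ψ '' R i)) (interior (Ψ '' R j)) := by
  have : ∀ S : Set Plane, interior (Ψ '' S) = Ψ '' interior S :=
    fun S => (Ψ.toHomeomorph.image_interior S).symm
  rw [this, this, disjoint_image_iff Ψ.injective]
  exact h.2 i j hij

theorem HasForm.unique {Ψ : Plane ≃L[ℝ] ℝ × ℝ} {M : Set Plane}
    {B B' : (ℝ →ₗ[ℚ] ℝ) → (ℝ →ₗ[ℚ] ℝ) → ℝ} (h : HasForm Ψ M B) (h' : HasForm Ψ M B')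
    (f g : ℝ →ₗ[ℚ] ℝ) : B f g = B' f g := by
  obtain ⟨N, R, x₀, x₁, y₀, y₁, hR, hS, hB⟩ := h
  obtain ⟨N', R', x₀', x₁', y₀', y₁', hR', hS', hB'⟩ := h'
  rw [hB, hB']
  simp only [map_sub]
  exact sum_sub_mul_sub_eq_of_iUnion_eq (hR.disjoint_interior_image Ψ)
    (hR'.disjoint_interior_image Ψ) hS hS' (by rw [← image_iUnion, ← image_iUnion, hR.1, hR'.1])
    f g

/-- Without its endpoints, a side of a simple closed polygonal line meets no other side. -/
theorem IsSimpleClosed.disjoint_openSegment {n : ℕ} {P : Polygon Plane n} (hP : IsSimpleClosed P)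
    {i j : Fin n} (hij : i ≠ j) :
    Disjoint (openSegment ℝ (P i) (P (finRotate n i))) (P.edgeSet ℝ j) := by
  have hsub : openSegment ℝ (P i) (P (finRotate n i)) ⊆ P.edgeSet ℝ i := by
    rw [Polygon.edgeSet, affineSegment_eq_segment]
    exact openSegment_subset_segment _ _ _
  by_cases h1 : j = finRotate n i
  · subst h1
    rw [disjoint_left]
    intro z hz hz'
    have : z ∈ ({P (finRotate n i)} : Set Plane) := hP.consecutive i ▸ ⟨hsub hz, hz'⟩
    rw [mem_singleton_iff.1 this, right_mem_openSegment_iff] at hz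
    exact hP.nondegenerate i hz
  · by_cases h2 : i = finRotate n j
    · rw [disjoint_left]
      intro z hz hz'
      have : z ∈ ({P (finRotate n j)} : Set Plane) :=
        hP.consecutive j ▸ ⟨hz', h2 ▸ hsub hz⟩
      rw [mem_singleton_iff.1 this, ← h2, left_mem_openSegment_iff] at hz
      exact hP.nondegenerate i hz
    · exact (hP.nonconsecutive i j hij.symm h1 h2).mono_left hsub

/-- If `f` vanishes on the side lengths of a polygon, it takes equal values at the abscissas of the
endpoints of each horizontal side, and the jumps occur along such sides only. -/
theorem HasForm.eq_zero_of_polygon {Ψ : Plane ≃L[ℝ] ℝ × ℝ} (hΨ : IsFrame Ψ) {M : Set Plane}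
    {B : (ℝ →ₗ[ℚ] ℝ) → (ℝ →ₗ[ℚ] ℝ) → ℝ} (h : HasForm Ψ M B) {K : Set ℝ}
    (hM : IsPolygonWithSidesIn K M) {f : ℝ →ₗ[ℚ] ℝ} (hf : ∀ x ∈ K, f x = 0) (g : ℝ →ₗ[ℚ] ℝ) :
    B f g = 0 := by
  obtain ⟨N, R, x₀, x₁, y₀, y₁, hR, hS, hB⟩ := h
  obtain ⟨k, n, P, hP, hK⟩ := hM
  rw [hB]
  simp only [map_sub]
  have hseg : ∀ e : (j : Fin k) × Fin (n j), Ψ '' (P e.1).edgeSet ℝ e.2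
      = segment ℝ (Ψ (P e.1 e.2)) (Ψ (P e.1 (finRotate _ e.2))) := by
    intro e
    rw [Polygon.edgeSet, affineSegment_eq_segment]
    exact image_segment ℝ (Ψ : Plane →ₗ[ℝ] ℝ × ℝ).toAffineMap _ _
  have hoseg : ∀ e : (j : Fin k) × Fin (n j),
      Ψ '' openSegment ℝ (P e.1 e.2) (P e.1 (finRotate _ e.2))
        = openSegment ℝ (Ψ (P e.1 e.2)) (Ψ (P e.1 (finRotate _ e.2))) :=
    fun e => image_openSegment ℝ (Ψ : Plane →ₗ[ℝ] ℝ × ℝ).toAffineMap _ _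
  refine sum_sub_mul_sub_eq_zero_of_frontier (E := (j : Fin k) × Fin (n j))
    (A := fun e => Ψ (P e.1 e.2)) (B := fun e => Ψ (P e.1 (finRotate _ e.2)))
    (hR.disjoint_interior_image Ψ) hS ?_ ?_ ?_ g
  · rw [← image_iUnion, hR.1]
    have : frontier (Ψ '' M) = Ψ '' frontier M := (Ψ.toHomeomorph.image_frontier M).symm
    rw [this, hP.frontier_eq, iUnion_sigma, image_iUnion]
    refine iUnion_congr fun j => ?_
    rw [Polygon.boundary, image_iUnion]
    exact iUnion_congr fun i => hseg ⟨j, i⟩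
  · intro e e' hee'
    rw [← hseg, ← hoseg, disjoint_image_iff Ψ.injective]
    obtain ⟨j, i⟩ := e
    obtain ⟨j', i'⟩ := e'
    by_cases hj : j = j'
    · subst hj
      exact (hP.simple j).disjoint_openSegment fun h => hee' (Sigma.ext rfl (heq_of_eq h))
    · refine (hP.disjoint j j' hj).mono ?_ (subset_iUnion _ i')
      refine Subset.trans ?_ (subset_iUnion _ i)
      rw [Polygon.edgeSet, affineSegment_eq_segment]
      exact openSegment_subset_segment _ _ _
  · rintro ⟨j, i⟩ h
    have hd := hf _ (hK j i)
    rw [dist_eq_norm] at hd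
    have hn := hΨ.norm_sq (P j i - P j (finRotate _ i))
    simp only [map_sub, Prod.fst_sub, Prod.snd_sub] at hn
    dsimp only at h
    rw [h, sub_self, zero_pow two_ne_zero, add_zero, sq_eq_sq_iff_eq_or_eq_neg] at hn
    rw [← sub_eq_zero, ← map_sub]
    rcases hn with hn | hn
    · rw [← hn, hd]
    · rw [← neg_eq_zero, ← map_neg, ← hn, hd]

/-- A dissection into rectangles is a dissection into pieces with known horizontal sides. The
horizontal width and the height of each of them are its side lengths `c i`, `d i` in one of the
two orders, or both zero if the rectangle is tilted. -/
theorem exists_hasForm {Ψ : Plane ≃L[ℝ] ℝ × ℝ} (hΨ : IsFrame Ψ) {M : Set Plane} {N : ℕ}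
    {R : Fin N → Set Plane} (hR : IsDissection M R) {O u v : Fin N → Plane}
    (hu : ∀ i, u i ≠ 0) (hv : ∀ i, v i ≠ 0) (huv : ∀ i, inner ℝ (u i) (v i) = 0)
    (hRp : ∀ i, R i = parallelogram (O i) (u i) (v i)) :
    ∃ w h : Fin N → ℝ, HasForm Ψ M (fun f g => ∑ i, f (w i) * g (h i)) ∧
      ∀ i, ((Ψ (u i)).2 = 0 ∧ w i = ‖u i‖ ∧ h i = ‖v i‖) ∨
        ((Ψ (u i)).2 ≠ 0 ∧ w i = ‖v i‖ ∧ h i = ‖u i‖) ∨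
        ((Ψ (u i)).2 ≠ 0 ∧ w i = 0 ∧ h i = 0) := by
  have := fun i => exists_hasSides hΨ (O := O i) (hu i) (hv i) (huv i)
  choose x₀ x₁ y₀ y₁ hS hc using this
  exact ⟨fun i => x₁ i - x₀ i, fun i => y₁ i - y₀ i,
    ⟨N, R, x₀, x₁, y₀, y₁, hR, fun i => by rw [hRp]; exact hS i, fun f g => rfl⟩, hc⟩

/-! ### Bounds on the side ratio -/

theorem IsRectangle.exists_parallelogram {c d : ℝ} {S : Set Plane} (h : IsRectangle c d S) :
    ∃ O u v : Plane, u ≠ 0 ∧ v ≠ 0 ∧ inner ℝ u v = 0 ∧ ‖u‖ = c ∧ ‖v‖ = d ∧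
      S = parallelogram O u v := by
  obtain ⟨hc, hd, O, u, v, hu, hv, huv, hS⟩ := h
  exact ⟨O, u, v, norm_pos_iff.1 (hu ▸ hc), norm_pos_iff.1 (hv ▸ hd), huv, hu, hv, hS⟩

theorem parallelogram_isRectangle {O u v : Plane} (hu : u ≠ 0) (hv : v ≠ 0)
    (huv : inner ℝ u v = 0) : IsRectangle ‖u‖ ‖v‖ (parallelogram O u v) :=
  ⟨norm_pos_iff.2 hu, norm_pos_iff.2 hv, O, u, v, rfl, rfl, huv, rfl⟩

theorem IsRectangle.symm {c d : ℝ} {S : Set Plane} (h : IsRectangle c d S) :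
    IsRectangle d c S := by
  obtain ⟨O, u, v, hu, hv, huv, rfl, rfl, rfl⟩ := h.exists_parallelogram
  rw [parallelogram_comm]
  exact parallelogram_isRectangle hv hu (by rw [real_inner_comm, huv])

theorem IsPolygonWithSidesIn.nonempty {K : Set ℝ} {M : Set Plane} (h : IsPolygonWithSidesIn K M) :
    M.Nonempty := by
  obtain ⟨_, _, _, hP, _⟩ := h
  exact hP.isConnected.nonempty

/-- The invariant of a set dissected into `c × d` rectangles, in the frame given by the sides of
one of them: it is counted by the numbers `m` and `n` of rectangles having the side of length `c`,
respectively `d`, horizontal. -/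
theorem exists_hasForm_of_congruent {c d : ℝ} {M : Set Plane} (hM : M.Nonempty) {N : ℕ}
    {R : Fin N → Set Plane} (hR : IsDissection M R) (hrect : ∀ i, IsRectangle c d (R i)) :
    ∃ (Ψ : Plane ≃L[ℝ] ℝ × ℝ) (m n : ℕ), IsFrame Ψ ∧ 0 < m ∧
      HasForm Ψ M (fun f g => m * (f c * g d) + n * (f d * g c)) := by
  classical
  have hN : ∃ i₀ : Fin N, True := by
    obtain ⟨z, hz⟩ := hM
    rw [← hR.1, mem_iUnion] at hz
    exact ⟨hz.choose, trivial⟩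
  obtain ⟨i₀, -⟩ := hN
  choose O u v hu hv huv hc hd hRp using fun i => (hrect i).exists_parallelogram
  obtain ⟨Ψ, hΨ, hΨ0⟩ := exists_isFrame (hu i₀) (hv i₀) (huv i₀)
  obtain ⟨w, h, ⟨N', R', x₀, x₁, y₀, y₁, hR', hS, hB⟩, htype⟩ := exists_hasForm hΨ hR hu hv huv hRp
  refine ⟨Ψ, (Finset.univ.filter fun i => (Ψ (u i)).2 = 0).card,
    (Finset.univ.filter fun i => (Ψ (u i)).2 ≠ 0 ∧ w i = d ∧ h i = c).card, hΨ,
    Finset.card_pos.2 ⟨i₀, by simp [hΨ0]⟩, N', R', x₀, x₁, y₀, y₁, hR', hS, fun f g => ?_⟩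
  rw [← hB]
  have hterm : ∀ i, f (w i) * g (h i) = (if (Ψ (u i)).2 = 0 then f c * g d else 0) +
      (if (Ψ (u i)).2 ≠ 0 ∧ w i = d ∧ h i = c then f d * g c else 0) := by
    intro i
    rcases htype i with ⟨h0, hw, hh⟩ | ⟨h0, hw, hh⟩ | ⟨h0, hw, hh⟩
    · simp [h0, hw, hh, hc, hd]
    · simp [h0, hw, hh, hc, hd]
    · by_cases hcase : w i = d ∧ h i = c
      · simp [h0, hcase]
      · rw [if_neg h0, if_neg fun h' => hcase h'.2, hw, map_zero, zero_mul, add_zero]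
  simp only [hterm, Finset.sum_add_distrib, ← Finset.sum_filter, Finset.sum_const, nsmul_eq_mul]

/-- The zero value of the parameter `t` accounts for the tilted rectangles. -/
theorem exists_hasForm_of_similar {r : ℝ} {M : Set Plane} (h : CutsIntoSimilar M r)
    {Ψ : Plane ≃L[ℝ] ℝ × ℝ} (hΨ : IsFrame Ψ) :
    ∃ (N : ℕ) (w h : Fin N → ℝ), HasForm Ψ M (fun f g => ∑ i, f (w i) * g (h i)) ∧
      ∀ i, ∃ t, (w i = r * t ∧ h i = t) ∨ (w i = t ∧ h i = r * t) := by
  obtain ⟨N, R, hR, hrect⟩ := h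
  choose c d hcd hrect using hrect
  choose O u v hu hv huv hc hd hRp using fun i => (hrect i).exists_parallelogram
  obtain ⟨w, h, hform, htype⟩ := exists_hasForm hΨ hR hu hv huv hRp
  refine ⟨N, w, h, hform, fun i => ?_⟩
  have hr : ‖u i‖ = r * ‖v i‖ := by
    have := norm_ne_zero_iff.2 (hv i)
    rw [← hcd i, ← hc, ← hd]; field_simp
  rcases htype i with ⟨-, hw, hh⟩ | ⟨-, hw, hh⟩ | ⟨-, hw, hh⟩
  · exact ⟨‖v i‖, .inl ⟨by rw [hw, hr], hh⟩⟩
  · exact ⟨‖v i‖, .inr ⟨hw, by rw [hh, hr]⟩⟩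
  · exact ⟨0, .inl ⟨by simp [hw], hh⟩⟩

/-- Taking both arguments of the invariant equal shows that `f` kills one of `c`, `d`; taking the
identity as second argument excludes that it kills `d` only. -/
theorem map_side_eq_zero {c d : ℝ} {K : Set ℝ} {M : Set Plane} (hM : IsPolygonWithSidesIn K M)
    {N : ℕ} {R : Fin N → Set Plane} (hR : IsDissection M R)
    (hrect : ∀ i, IsRectangle c d (R i)) {f : ℝ →ₗ[ℚ] ℝ} (hf : ∀ x ∈ K, f x = 0) : f c = 0 := by
  obtain ⟨Ψ, m, n, hΨ, hm, hform⟩ := exists_hasForm_of_congruent hM.nonempty hR hrect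
  have hd : d ≠ 0 := by
    obtain ⟨z, hz⟩ := hM.nonempty
    rw [← hR.1, mem_iUnion] at hz
    exact (hrect hz.choose).2.1.ne'
  have h1 := hform.eq_zero_of_polygon hΨ hM hf f
  have h2 := hform.eq_zero_of_polygon hΨ hM hf LinearMap.id
  have hm' : (0 : ℝ) < m := by exact_mod_cast hm
  have hn' : (0 : ℝ) ≤ n := n.cast_nonneg
  have h3 : ((m : ℝ) + n) * (f c * f d) = 0 := by linear_combination h1
  rcases mul_eq_zero.1 ((mul_eq_zero.1 h3).resolve_left (by positivity)) with h | h
  · exact h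
  · rw [h] at h2
    simpa [hm'.ne', hd] using h2

theorem mem_quadRat_iff_mem_span {p : ℚ} {x : ℝ} :
    x ∈ quadRat p ↔ x ∈ Submodule.span ℚ {(1 : ℝ), √(p : ℝ)} := by
  rw [Submodule.mem_span_pair]
  simp [quadRat, Rat.smul_def, eq_comm]

theorem side_mem_quadRat {c d : ℝ} {p : ℚ} {M : Set Plane}
    (hM : IsPolygonWithSidesIn (quadRat p) M) {N : ℕ} {R : Fin N → Set Plane}
    (hR : IsDissection M R) (hrect : ∀ i, IsRectangle c d (R i)) : c ∈ quadRat p := by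
  rw [mem_quadRat_iff_mem_span]
  by_contra hc
  obtain ⟨f, hfc, hf⟩ := Submodule.exists_le_ker_of_notMem hc
  let F : ℝ →ₗ[ℚ] ℝ := (Algebra.linearMap ℚ ℝ).comp f
  have hF : F c = 0 := by
    refine map_side_eq_zero hM hR hrect fun x hx => ?_
    have : f x = 0 := hf (mem_quadRat_iff_mem_span.1 hx)
    simp [F, this]
  exact hfc (by simpa [F] using hF)

theorem sub_mul_sqrt_ne_zero {p e f : ℚ} (hirr : Irrational √(p : ℝ))
    (h : (e : ℝ) + f * √(p : ℝ) ≠ 0) : (e : ℝ) - f * √(p : ℝ) ≠ 0 := by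
  intro h0
  by_cases hf : f = 0
  · subst hf
    have : (e : ℝ) = 0 := by simpa using h0
    simp [this] at h
  · refine hirr ⟨e / f, ?_⟩
    have : (f : ℝ) ≠ 0 := by exact_mod_cast hf
    push_cast
    field_simp
    linarith

theorem div_mem_quadRat {p : ℚ} (hp : 0 < p) (hirr : Irrational √(p : ℝ)) {c d : ℝ}
    (hc : c ∈ quadRat p) (hd : d ∈ quadRat p) (hd0 : d ≠ 0) : c / d ∈ quadRat p := by
  obtain ⟨c₁, c₂, rfl⟩ := hc
  obtain ⟨d₁, d₂, rfl⟩ := hd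
  have h' := sub_mul_sqrt_ne_zero hirr hd0
  have hs : √(p : ℝ) * √(p : ℝ) = p := Real.mul_self_sqrt (by exact_mod_cast hp.le)
  have hprod : ((d₁ : ℝ) + d₂ * √p) * (d₁ - d₂ * √p) = d₁ ^ 2 - p * d₂ ^ 2 := by
    linear_combination (-(d₂ : ℝ) ^ 2) * hs
  have hn : (d₁ : ℝ) ^ 2 - p * d₂ ^ 2 ≠ 0 := hprod ▸ mul_ne_zero hd0 h'
  refine ⟨(c₁ * d₁ - p * c₂ * d₂) / (d₁ ^ 2 - p * d₂ ^ 2),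
    (c₂ * d₁ - c₁ * d₂) / (d₁ ^ 2 - p * d₂ ^ 2), ?_⟩
  rw [div_eq_iff hd0]
  push_cast
  rw [div_mul_eq_mul_div, ← add_div, div_mul_eq_mul_div, eq_div_iff hn]
  linear_combination (-((c₂ : ℝ) * d₁ - c₁ * d₂) * d₂) * hs

/-- There are additive functions which are semilinear with respect to the conjugation of
`ℚ[√p]` and do not vanish at a given `d ≠ 0`. -/
theorem exists_semilinear {p : ℚ} (hp : 0 < p) (hirr : Irrational √(p : ℝ)) {d : ℝ} (hd : d ≠ 0) :
    ∃ σ : ℝ →ₗ[ℚ] ℝ, σ d ≠ 0 ∧ ∀ (a b : ℚ) (x : ℝ),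
      σ ((a + b * √(p : ℝ)) * x) = (a - b * √(p : ℝ)) * σ x := by
  have hs : √(p : ℝ) * √(p : ℝ) = p := Real.mul_self_sqrt (by exact_mod_cast hp.le)
  have hnot : √(p : ℝ) * d ∉ Submodule.span ℚ {d} := by
    rw [Submodule.mem_span_singleton]
    rintro ⟨q, hq⟩
    rw [Rat.smul_def] at hq
    exact hirr ⟨q, mul_right_cancel₀ hd hq⟩
  obtain ⟨h, hne, hker⟩ := Submodule.exists_le_ker_of_notMem hnot
  have hhd : h d = 0 := hker (Submodule.mem_span_singleton_self d)
  -- multiplication by `√p` sends `x ↦ h (√p x) - √p h x` to its multiple by `-√p`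
  let σ : ℝ →ₗ[ℚ] ℝ :=
    { toFun := fun x => (h (√(p : ℝ) * x) : ℝ) - √(p : ℝ) * (h x : ℝ)
      map_add' := fun x y => by simp only [mul_add, map_add, Rat.cast_add]; ring
      map_smul' := fun q x => by
        rw [mul_smul_comm, map_smul, map_smul, smul_eq_mul, smul_eq_mul, Rat.cast_mul,
          Rat.cast_mul, RingHom.id_apply, Rat.smul_def]
        ring }
  have hσ : ∀ x, σ x = (h (√(p : ℝ) * x) : ℝ) - √(p : ℝ) * (h x : ℝ) := fun _ => rfl
  have hsqrt : ∀ x, σ (√(p : ℝ) * x) = -√(p : ℝ) * σ x := by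
    intro x
    have : √(p : ℝ) * (√(p : ℝ) * x) = p • x := by rw [← mul_assoc, hs, Rat.smul_def]
    rw [hσ, hσ, this, map_smul, smul_eq_mul, Rat.cast_mul]
    linear_combination (-(h x : ℝ)) * hs
  refine ⟨σ, by simpa [hσ, hhd] using hne, fun a b x => ?_⟩
  have : ((a : ℝ) + b * √(p : ℝ)) * x = a • x + b • (√(p : ℝ) * x) := by
    simp only [Rat.smul_def]; ring
  rw [this, map_add, map_smul, map_smul, hsqrt, Rat.smul_def, Rat.smul_def]
  ring

/-- A combination of the invariants of `(id, id)`, `(σ, σ)`, `(id, σ)` and `(σ, id)` to which every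
rectangle with side ratio `r` contributes nonnegatively is nonnegative on `c × d` rectangles. -/
theorem quadratic_form_nonneg {r r' y y' c d : ℝ} {M : Set Plane} (hM : M.Nonempty) {N : ℕ}
    {R : Fin N → Set Plane} (hR : IsDissection M R) (hrect : ∀ i, IsRectangle c d (R i))
    (hsim : CutsIntoSimilar M r) (hcd : c = y * d) {σ : ℝ →ₗ[ℚ] ℝ}
    (hσr : ∀ x, σ (r * x) = r' * σ x) (hσy : ∀ x, σ (y * x) = y' * σ x) {A C D : ℝ}
    (hpos : ∀ x z, 0 ≤ A * r * x ^ 2 + C * r' * z ^ 2 + D * (r + r') * x * z) :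
    0 ≤ A * y * d ^ 2 + C * y' * σ d ^ 2 + D * (y + y') * d * σ d := by
  obtain ⟨Ψ, m, n, hΨ, hm, hform⟩ := exists_hasForm_of_congruent hM hR hrect
  obtain ⟨k, w, h, hform', ht⟩ := exists_hasForm_of_similar hsim hΨ
  have hu := hform.unique hform'
  have hm' : (0 : ℝ) < m := by exact_mod_cast hm
  have hn' : (0 : ℝ) ≤ n := n.cast_nonneg
  have hsum : 0 ≤ A * ∑ i, w i * h i + C * ∑ i, σ (w i) * σ (h i)
      + D * (∑ i, w i * σ (h i) + ∑ i, σ (w i) * h i) := by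
    simp only [mul_add, Finset.mul_sum, ← Finset.sum_add_distrib]
    refine Finset.sum_nonneg fun i _ => ?_
    obtain ⟨t, ⟨h1, h2⟩ | ⟨h1, h2⟩⟩ := ht i
    all_goals
      rw [h1, h2, hσr]
      linarith [hpos t (σ t)]
  have e1 := hu LinearMap.id LinearMap.id
  have e2 := hu σ σ
  have e3 := hu LinearMap.id σ
  have e4 := hu σ LinearMap.id
  simp only [LinearMap.id_coe, id_eq] at e1 e2 e3 e4
  rw [← e1, ← e2, ← e3, ← e4, hcd, hσy] at hsum
  refine nonneg_of_mul_nonneg_right (a := (m : ℝ) + n) ?_ (by positivity)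
  linarith

/-- If nonnegativity of the form with coefficients `A r`, `C q`, `D S` always entails nonnegativity of
the value at `(X, Z)` of the form with coefficients `A y`, `C k`, `D T`, then the discriminants compare
as stated. The extremal forms are the perfect squares `(√(k r) Z x ± √(y q) X z)²`. -/
theorem mul_sq_le_of_forms {r q S y k T X Z : ℝ} (hr : 0 < r) (hq : 0 < q) (hy : 0 < y)
    (hk : k ≠ 0) (hX : X ≠ 0) (hZ : Z ≠ 0)
    (H : ∀ A C D : ℝ, (∀ x z, 0 ≤ A * r * x ^ 2 + C * q * z ^ 2 + D * S * x * z) →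
      0 ≤ A * y * X ^ 2 + C * k * Z ^ 2 + D * T * X * Z) :
    0 < k ∧ r * q * T ^ 2 ≤ y * k * S ^ 2 := by
  have hXp : 0 < X ^ 2 := by positivity
  have hZp : 0 < Z ^ 2 := by positivity
  have hkp : 0 < k := by
    have := H 0 1 0 fun x z => by simp only [zero_mul, one_mul, zero_add, add_zero]; positivity
    simp only [zero_mul, one_mul, zero_add, add_zero] at this
    exact (nonneg_of_mul_nonneg_left this hZp).lt_of_ne hk.symm
  refine ⟨hkp, ?_⟩
  by_cases hS : S = 0
  · subst hS
    have h1 := H 0 0 1 (by simp)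
    have h2 := H 0 0 (-1) (by simp)
    have : T * X * Z = 0 := by linarith
    have hT : T = 0 := by simpa [hX, hZ] using this
    simp [hT]
  · set α := √(k * r) with hα
    set β := √(y * q) with hβ
    have hα2 : α ^ 2 = k * r := Real.sq_sqrt (by positivity)
    have hβ2 : β ^ 2 = y * q := Real.sq_sqrt (by positivity)
    -- the weights which make the first form equal to `(α Z x ± β X z) ^ 2`
    have key : ∀ ε : ℝ, ε ^ 2 = 1 → 0 ≤ y * k + ε * (α * β * T / S) := by
      intro ε hε
      have := H (k * Z ^ 2) (y * X ^ 2) (2 * ε * (α * β * X * Z / S)) fun x z => by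
        have : k * Z ^ 2 * r * x ^ 2 + y * X ^ 2 * q * z ^ 2 +
            2 * ε * (α * β * X * Z / S) * S * x * z = (α * Z * x + ε * β * X * z) ^ 2 := by
          field_simp
          linear_combination (-(Z ^ 2 * x ^ 2)) * hα2 - (X ^ 2 * z ^ 2 * ε ^ 2) * hβ2
            - y * q * X ^ 2 * z ^ 2 * hε
        rw [this]; positivity
      have h2 : 0 ≤ (y * k + ε * (α * β * T / S)) * (2 * X ^ 2 * Z ^ 2) := by
        refine this.trans_eq ?_
        field_simp; ring
      exact nonneg_of_mul_nonneg_left h2 (by positivity)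
    have h1 := key 1 (by norm_num)
    have h2 := key (-1) (by norm_num)
    have h3 : (α * β * T / S) ^ 2 ≤ (y * k) ^ 2 := by
      rw [sq_le_sq, abs_of_pos (a := y * k) (by positivity), abs_le]
      constructor <;> linarith
    rw [div_pow, div_le_iff₀ (by positivity), mul_pow, mul_pow, hα2, hβ2] at h3
    refine le_of_mul_le_mul_left ?_ (show 0 < y * k by positivity)
    linarith

/-- The necessary conditions on the ratio of the congruent rectangles, in both cases. -/
theorem bounds_of_cuts {a b p : ℚ} (hp : 0 < p) (hirr : Irrational √(p : ℝ))
    (hr : 0 < (a : ℝ) + b * √(p : ℝ)) {M : Set Plane} {y : ℝ}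
    (hM : IsPolygonWithSidesIn (quadRat p) M) (hy : CutsIntoEqual M y)
    (hsim : CutsIntoSimilar M ((a : ℝ) + b * √(p : ℝ))) :
    ∃ e f : ℚ, y = (e : ℝ) + f * √(p : ℝ) ∧
      (0 < (a : ℝ) - b * √(p : ℝ) → 0 < e ∧ |f| / e ≤ |b| / a) ∧
      ((a : ℝ) - b * √(p : ℝ) < 0 → 0 < f ∧ |e| / f ≤ |a| / b) := by
  obtain ⟨c, d, hcd, N, R, hR, hrect⟩ := hy
  obtain ⟨z, hz⟩ := hM.nonempty
  have hz' := hz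
  rw [← hR.1, mem_iUnion] at hz'
  obtain ⟨hc, hd, -⟩ := hrect hz'.choose
  have hcd' : c = y * d := by rw [← hcd]; field_simp
  have hy0 : 0 < y := by rw [← hcd]; positivity
  obtain ⟨e, f, hef⟩ := div_mem_quadRat hp hirr (side_mem_quadRat hM hR hrect)
    (side_mem_quadRat hM hR fun i => (hrect i).symm) hd.ne'
  rw [hcd] at hef
  obtain ⟨σ, hσd, hσ⟩ := exists_semilinear hp hirr hd.ne'
  have hs0 : 0 < √(p : ℝ) := Real.sqrt_pos.2 (by exact_mod_cast hp)
  have hs : √(p : ℝ) * √(p : ℝ) = p := Real.mul_self_sqrt (by exact_mod_cast hp.le)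
  have hy' : (e : ℝ) - f * √(p : ℝ) ≠ 0 := sub_mul_sqrt_ne_zero hirr (hef ▸ hy0.ne')
  have H : ∀ A C D : ℝ, (∀ x z : ℝ, 0 ≤ A * (a + b * √(p : ℝ)) * x ^ 2 +
      C * (a - b * √(p : ℝ)) * z ^ 2 + D * (a + b * √(p : ℝ) + (a - b * √(p : ℝ))) * x * z) →
      0 ≤ A * y * d ^ 2 + C * (e - f * √(p : ℝ)) * σ d ^ 2 +
        D * (y + (e - f * √(p : ℝ))) * d * σ d := fun A C D hpos =>
    quadratic_form_nonneg hM.nonempty hR hrect hsim hcd' (hσ a b) (by rw [hef]; exact hσ e f) hpos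
  have hpR : (0 : ℝ) < p := by exact_mod_cast hp
  refine ⟨e, f, hef, fun hr' => ?_, fun hr' => ?_⟩
  · obtain ⟨hk, hle⟩ := mul_sq_le_of_forms hr hr' hy0 hy' hd.ne' hσd H
    have ha : 0 < a := by
      have : (0 : ℝ) < a := by linarith
      exact_mod_cast this
    have he : 0 < e := by
      have : (0 : ℝ) < e := by rw [hef] at hy0; linarith
      exact_mod_cast this
    refine ⟨he, ?_⟩
    have h1 : (p : ℝ) * ((f : ℝ) ^ 2 * a ^ 2) ≤ p * ((b : ℝ) ^ 2 * e ^ 2) := by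
      rw [hef] at hle
      have e1 : ((a : ℝ) + b * √p) * (a - b * √p) = a ^ 2 - p * b ^ 2 := by
        linear_combination (-(b : ℝ) ^ 2) * hs
      have e2 : ((e : ℝ) + f * √p) * (e - f * √p) = e ^ 2 - p * f ^ 2 := by
        linear_combination (-(f : ℝ) ^ 2) * hs
      rw [e1, e2] at hle
      linarith
    have h2 : f ^ 2 * a ^ 2 ≤ b ^ 2 * e ^ 2 := by exact_mod_cast le_of_mul_le_mul_left h1 hpR
    rw [div_le_div_iff₀ he ha]
    rw [← mul_pow, ← mul_pow, sq_le_sq, abs_mul, abs_mul, abs_of_pos ha, abs_of_pos he] at h2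
    exact h2
  · -- the conjugates are negative, so the quadratic forms are rewritten with their opposites
    obtain ⟨hk, hle⟩ := mul_sq_le_of_forms (S := a + b * √(p : ℝ) + (a - b * √(p : ℝ)))
      (T := y + (e - f * √(p : ℝ))) hr (neg_pos.2 hr') hy0 (neg_ne_zero.2 hy') hd.ne' hσd
      fun A C D hpos => by
        have := H A (-C) D fun x z => (hpos x z).trans_eq (by ring)
        exact this.trans_eq (by ring)
    have hb : 0 < b := by
      have : (0 : ℝ) < b := pos_of_mul_pos_left (by linarith : (0 : ℝ) < b * √p) hs0.le
      exact_mod_cast this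
    have hf : 0 < f := by
      have : (0 : ℝ) < f := by
        rw [hef] at hy0
        exact pos_of_mul_pos_left (by linarith : (0 : ℝ) < f * √p) hs0.le
      exact_mod_cast this
    refine ⟨hf, ?_⟩
    have h1 : (p : ℝ) * ((e : ℝ) ^ 2 * b ^ 2) ≤ p * ((a : ℝ) ^ 2 * f ^ 2) := by
      rw [hef] at hle
      have e1 : ((a : ℝ) + b * √p) * -(a - b * √p) = p * b ^ 2 - a ^ 2 := by
        linear_combination ((b : ℝ) ^ 2) * hs
      have e2 : ((e : ℝ) + f * √p) * -(e - f * √p) = p * f ^ 2 - e ^ 2 := by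
        linear_combination ((f : ℝ) ^ 2) * hs
      rw [e1, e2] at hle
      linarith
    have h2 : e ^ 2 * b ^ 2 ≤ a ^ 2 * f ^ 2 := by exact_mod_cast le_of_mul_le_mul_left h1 hpR
    rw [div_le_div_iff₀ hf hb]
    rw [← mul_pow, ← mul_pow, sq_le_sq, abs_mul, abs_mul, abs_of_pos hb, abs_of_pos hf] at h2
    exact h2

/-! ### Constructing dissections -/

theorem cutsIntoSimilar_iUnion {ι : Type*} [Fintype ι] {S : ι → Set Plane} {r : ℝ}
    (hS : ∀ i j, i ≠ j → Disjoint (interior (S i)) (interior (S j)))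
    (h : ∀ i, CutsIntoSimilar (S i) r) : CutsIntoSimilar (⋃ i, S i) r := by
  choose N R hR hrect using h
  let e := Fintype.equivFin ((i : ι) × Fin (N i))
  refine ⟨_, fun k => R (e.symm k).1 (e.symm k).2, ⟨?_, fun k l hkl => ?_⟩,
    fun k => hrect (e.symm k).1 (e.symm k).2⟩
  · rw [e.symm.surjective.iUnion_comp fun k => R k.1 k.2, iUnion_sigma]
    exact iUnion_congr fun i => (hR i).1
  · have hne : e.symm k ≠ e.symm l := e.symm.injective.ne hkl
    dsimp only
    generalize e.symm k = k' at hne ⊢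
    generalize e.symm l = l' at hne ⊢
    obtain ⟨i, k'⟩ := k'
    obtain ⟨j, l'⟩ := l'
    by_cases hij : i = j
    · subst hij
      exact (hR i).2 _ _ fun h => hne (Sigma.ext rfl (heq_of_eq h))
    · refine (hS i j hij).mono (interior_mono ?_) (interior_mono ?_)
      · rw [← (hR i).1]; exact subset_iUnion _ _
      · rw [← (hR j).1]; exact subset_iUnion _ _

/-- Every rectangle whose side ratio is `x` can be cut into rectangles with side ratio `r`. -/
def RatioCuts (r x : ℝ) : Prop :=
  ∀ O u v : Plane, u ≠ 0 → v ≠ 0 → inner ℝ u v = 0 → ‖u‖ = x * ‖v‖ →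
    CutsIntoSimilar (parallelogram O u v) r

theorem ratioCuts_self (r : ℝ) : RatioCuts r r := by
  intro O u v hu hv huv hr
  refine ⟨1, fun _ => parallelogram O u v, ⟨iUnion_const _, fun i j hij => ?_⟩, fun _ => ?_⟩
  · exact absurd (Subsingleton.elim i j) hij
  · exact ⟨_, _, by rw [hr, mul_div_cancel_right₀ _ (norm_ne_zero_iff.2 hv)],
      parallelogram_isRectangle hu hv huv⟩

theorem RatioCuts.inv {r x : ℝ} (hx : 0 < x) (h : RatioCuts r x) : RatioCuts r x⁻¹ := by
  intro O u v hu hv huv hr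
  rw [parallelogram_comm]
  exact h O v u hv hu (by rw [real_inner_comm, huv]) (by rw [hr]; field_simp)

/-- A cut across the side `u` at the parameter `l`. -/
theorem parallelogram_split {O u v : Plane} {l : ℝ} (h0 : 0 < l) (h1 : l < 1) :
    parallelogram O (l • u) v ∪ parallelogram (O + l • u) ((1 - l) • u) v
      = parallelogram O u v := by
  have hl : 0 < 1 - l := by linarith
  ext z
  constructor
  · rintro (⟨s, hs, t, ht, rfl⟩ | ⟨s, hs, t, ht, rfl⟩)
    · exact ⟨s * l, ⟨mul_nonneg hs.1 h0.le, mul_le_one₀ hs.2 h0.le h1.le⟩, t, ht, by module⟩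
    · refine ⟨l + s * (1 - l), ⟨?_, ?_⟩, t, ht, by module⟩
      · have := mul_nonneg hs.1 hl.le; linarith
      · have := mul_le_of_le_one_left hl.le hs.2; linarith
  · rintro ⟨s, hs, t, ht, rfl⟩
    rcases le_total s l with h | h
    · refine Or.inl ⟨s / l, ⟨div_nonneg hs.1 h0.le, (div_le_one h0).2 h⟩, t, ht, ?_⟩
      rw [smul_smul, div_mul_cancel₀ _ h0.ne']
    · refine Or.inr ⟨(s - l) / (1 - l), ⟨div_nonneg (by linarith) hl.le,
        (div_le_one hl).2 (by linarith [hs.2])⟩, t, ht, ?_⟩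
      rw [smul_smul, div_mul_cancel₀ _ hl.ne']
      module

theorem disjoint_interior_of_inner_le {S T : Set Plane} {u : Plane} (hu : u ≠ 0) {c : ℝ}
    (hS : ∀ z ∈ S, inner ℝ u z ≤ c) (hT : ∀ z ∈ T, c ≤ inner ℝ u z) :
    Disjoint (interior S) (interior T) := by
  rw [disjoint_left]
  intro z hzS hzT
  have hlim : Tendsto (fun ε : ℝ => z + ε • u) (𝓝[>] 0) (𝓝 z) := by
    have : Continuous fun ε : ℝ => z + ε • u := by fun_prop
    simpa using (this.tendsto 0).mono_left nhdsWithin_le_nhds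
  obtain ⟨ε, hε, hεS⟩ := (Filter.Eventually.and (self_mem_nhdsWithin : ∀ᶠ ε in 𝓝[>] (0 : ℝ), 0 < ε)
    (hlim.eventually (isOpen_interior.mem_nhds hzS))).exists
  have h1 := hS _ (interior_subset hεS)
  have h2 := hT _ (interior_subset hzT)
  rw [inner_add_right, inner_smul_right] at h1
  have h3 : 0 < ε * inner ℝ u u := mul_pos hε (by rw [real_inner_self_eq_norm_sq]; positivity)
  linarith

/-- Rectangles with the common side `v` placed next to each other. -/
theorem RatioCuts.add {r x x' : ℝ} (hx : 0 < x) (hx' : 0 < x') (h : RatioCuts r x)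
    (h' : RatioCuts r x') : RatioCuts r (x + x') := by
  intro O u v hu hv huv hr
  set l := x / (x + x') with hl
  have hl0 : 0 < l := by positivity
  have hl1 : l < 1 := (div_lt_one (by positivity)).2 (by linarith)
  have hl1' : 0 < 1 - l := by linarith
  rw [← parallelogram_split hl0 hl1, union_eq_iUnion]
  refine cutsIntoSimilar_iUnion ?_ ?_
  · have key : Disjoint (interior (parallelogram O (l • u) v))
        (interior (parallelogram (O + l • u) ((1 - l) • u) v)) := by
      have hpos : 0 < inner ℝ u u := by rw [real_inner_self_eq_norm_sq]; positivity
      refine disjoint_interior_of_inner_le hu (c := inner ℝ u O + l * inner ℝ u u) ?_ ?_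
      · rintro z ⟨s, hs, t, ht, rfl⟩
        simp only [inner_add_right, inner_smul_right, huv, mul_zero, add_zero]
        have := mul_le_of_le_one_left (mul_nonneg hl0.le hpos.le) hs.2
        linarith
      · rintro z ⟨s, hs, t, ht, rfl⟩
        simp only [inner_add_right, inner_smul_right, huv, mul_zero, add_zero]
        have := mul_nonneg hs.1 (mul_nonneg hl1'.le hpos.le)
        linarith
    rintro (_ | _) (_ | _) hij
    exacts [absurd rfl hij, key.symm, key, absurd rfl hij]
  · rintro (_ | _)
    · refine h' _ _ _ (smul_ne_zero hl1'.ne' hu) hv (by rw [inner_smul_left, huv, mul_zero]) ?_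
      rw [norm_smul, Real.norm_of_nonneg hl1'.le, hr, hl]
      field_simp; ring
    · refine h _ _ _ (smul_ne_zero hl0.ne' hu) hv (by rw [inner_smul_left, huv, mul_zero]) ?_
      rw [norm_smul, Real.norm_of_nonneg hl0.le, hr, hl]
      field_simp

theorem RatioCuts.natCast_mul {r x : ℝ} (hx : 0 < x) (h : RatioCuts r x) (k : ℕ) :
    RatioCuts r ((k + 1 : ℕ) * x) := by
  induction k with
  | zero => simpa using h
  | succ k ih =>
    have := RatioCuts.add (by positivity) hx ih h
    convert this using 1
    push_cast; ring

theorem RatioCuts.ratCast_mul {r x : ℝ} (hx : 0 < x) (h : RatioCuts r x) {q : ℚ} (hq : 0 < q) :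
    RatioCuts r (q * x) := by
  have hnum := Rat.num_pos.2 hq
  obtain ⟨k, hk⟩ : ∃ k : ℕ, q.num = ((k + 1 : ℕ) : ℤ) :=
    ⟨q.num.toNat - 1, by omega⟩
  obtain ⟨l, hl⟩ : ∃ l : ℕ, q.den = l + 1 := ⟨q.den - 1, by have := q.pos; omega⟩
  have h1 := (RatioCuts.natCast_mul (inv_pos.2 hx) (h.inv hx) l).inv (by positivity)
  have h2 := RatioCuts.natCast_mul (by positivity) h1 k
  have hqe : (q : ℝ) = (k + 1 : ℕ) / (l + 1 : ℕ) := by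
    conv_lhs => rw [← Rat.num_div_den q, hk, hl]
    push_cast; rfl
  convert h2 using 1
  rw [hqe]; field_simp

theorem ratioCuts_combination {r : ℝ} (hr : 0 < r) {q s : ℚ} (hq : 0 ≤ q) (hs : 0 ≤ s)
    (hqs : 0 < q + s) : RatioCuts r (q * r + s * r⁻¹) := by
  have hr' := inv_pos.2 hr
  have hself := ratioCuts_self r
  rcases hq.eq_or_lt with rfl | hq
  · simpa using RatioCuts.ratCast_mul hr' (hself.inv hr) (by simpa using hqs)
  · rcases hs.eq_or_lt with rfl | hs
    · simpa using RatioCuts.ratCast_mul hr hself hq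
    · have hqR : (0 : ℝ) < q := by exact_mod_cast hq
      have hsR : (0 : ℝ) < s := by exact_mod_cast hs
      exact RatioCuts.add (by positivity) (by positivity) (hself.ratCast_mul hr hq)
        ((hself.inv hr).ratCast_mul hr' hs)

theorem CutsIntoEqual.cutsIntoSimilar {M : Set Plane} {y r : ℝ} (h : CutsIntoEqual M y)
    (hy : RatioCuts r y) : CutsIntoSimilar M r := by
  obtain ⟨c, d, hcd, N, R, hR, hrect⟩ := h
  rw [← hR.1]
  refine cutsIntoSimilar_iUnion hR.2 fun i => ?_
  obtain ⟨O, u, v, hu, hv, huv, hc, hd, hRi⟩ := (hrect i).exists_parallelogram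
  rw [hRi]
  refine hy O u v hu hv huv ?_
  have := norm_ne_zero_iff.2 hv
  rw [← hcd, ← hc, ← hd]; field_simp

/-- The case `b = 0` is included: the hypothesis then forces `f = 0`. -/
theorem div_mul_cancel_and_abs_div_le {a b e f : ℚ} (ha : 0 < a) (he : 0 < e)
    (h : |f| / e ≤ |b| / a) : f / b * b = f ∧ |f / b| ≤ e / a := by
  rw [div_le_div_iff₀ he ha] at h
  by_cases hb : b = 0
  · subst hb
    rw [abs_zero, zero_mul] at h
    have hf : f = 0 := abs_eq_zero.1 (le_antisymm (nonpos_of_mul_nonpos_left h ha) (abs_nonneg f))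
    subst hf
    simp only [zero_div, zero_mul, abs_zero, true_and]
    positivity
  · refine ⟨div_mul_cancel₀ _ hb, ?_⟩
    rw [abs_div, div_le_div_iff₀ (abs_pos.2 hb) ha]
    linarith

end RectDissection

open RectDissection in
theorem mainTheorem2 (a b p : ℚ) (hp : 0 < p) (hirr : Irrational (Real.sqrt (p : ℝ)))
    (hr : 0 < (a : ℝ) + (b : ℝ) * Real.sqrt (p : ℝ))
    (M : Set RectDissection.Plane) (y : ℝ)
    (hM : RectDissection.IsPolygonWithSidesIn (RectDissection.quadRat p) M)
    (hy : RectDissection.CutsIntoEqual M y) :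
    (0 < (a : ℝ) - (b : ℝ) * Real.sqrt (p : ℝ) →
      (RectDissection.CutsIntoSimilar M ((a : ℝ) + (b : ℝ) * Real.sqrt (p : ℝ)) ↔
        ∃ e f : ℚ, y = (e : ℝ) + (f : ℝ) * Real.sqrt (p : ℝ) ∧ 0 < e ∧ |f| / e ≤ |b| / a)) ∧
    ((a : ℝ) - (b : ℝ) * Real.sqrt (p : ℝ) < 0 →
      (RectDissection.CutsIntoSimilar M ((a : ℝ) + (b : ℝ) * Real.sqrt (p : ℝ)) ↔
        ∃ e f : ℚ, y = (e : ℝ) + (f : ℝ) * Real.sqrt (p : ℝ) ∧ 0 < f ∧ |e| / f ≤ |a| / b)) := by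
  have hs0 : 0 < √(p : ℝ) := Real.sqrt_pos.2 (by exact_mod_cast hp)
  have hs : √(p : ℝ) * √(p : ℝ) = p := Real.mul_self_sqrt (by exact_mod_cast hp.le)
  have hnorm : ((a : ℝ) + b * √(p : ℝ)) * (a - b * √(p : ℝ)) = (a ^ 2 - p * b ^ 2 : ℚ) := by
    push_cast
    linear_combination (-(b : ℝ) ^ 2) * hs
  refine ⟨fun hr' => ⟨fun h => ?_, ?_⟩, fun hr' => ⟨fun h => ?_, ?_⟩⟩
  · obtain ⟨e, f, hef, h1, -⟩ := bounds_of_cuts hp hirr hr hM hy h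
    exact ⟨e, f, hef, h1 hr'⟩
  · rintro ⟨e, f, rfl, he, hle⟩
    have ha : 0 < a := by
      have : (0 : ℝ) < a := by linarith
      exact_mod_cast this
    have hn : 0 < a ^ 2 - p * b ^ 2 := by
      have : (0 : ℝ) < (a ^ 2 - p * b ^ 2 : ℚ) := hnorm ▸ mul_pos hr hr'
      exact_mod_cast this
    obtain ⟨hfb, habs⟩ := div_mul_cancel_and_abs_div_le ha he hle
    obtain ⟨h1, h2⟩ := abs_le.1 habs
    have hea : 0 < e / a := div_pos he ha
    -- `y` is the combination `q r + s r'` of `r` and its conjugate `r'`, and `r' = (r r') r⁻¹`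
    set q := (e / a + f / b) / 2 with hq
    set s := (e / a - f / b) / 2 with hs'
    have hq0 : 0 ≤ q := by linarith
    have hs0' : 0 ≤ s := by linarith
    have hqs : 0 < q + s * (a ^ 2 - p * b ^ 2) := by
      rcases hq0.eq_or_lt with h | h
      · have : 0 < s := by linarith
        rw [← h, zero_add]; positivity
      · positivity
    refine hy.cutsIntoSimilar ?_
    convert ratioCuts_combination hr hq0 (mul_nonneg hs0' hn.le) hqs using 1
    rw [Rat.cast_mul, ← hnorm, mul_assoc, mul_comm ((a : ℝ) + _), mul_assoc,
      mul_inv_cancel₀ hr.ne', mul_one]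
    have e1 : (e : ℝ) = (q + s) * a := by
      have : e = (q + s) * a := by rw [hq, hs']; field_simp; ring
      exact_mod_cast this
    have e2 : (f : ℝ) = (q - s) * b := by
      have : f = (q - s) * b := by rw [hq, hs']; linear_combination -hfb
      exact_mod_cast this
    rw [e1, e2]; ring
  · obtain ⟨e, f, hef, -, h1⟩ := bounds_of_cuts hp hirr hr hM hy h
    exact ⟨e, f, hef, h1 hr'⟩
  · rintro ⟨e, f, rfl, hf, hle⟩
    have hb : 0 < b := by
      have : (0 : ℝ) < b := pos_of_mul_pos_left (by linarith : (0 : ℝ) < b * √p) hs0.le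
      exact_mod_cast this
    have hn : 0 < -(a ^ 2 - p * b ^ 2) := by
      have : ((a ^ 2 - p * b ^ 2 : ℚ) : ℝ) < 0 := hnorm ▸ mul_neg_of_pos_of_neg hr hr'
      have : a ^ 2 - p * b ^ 2 < 0 := by exact_mod_cast this
      linarith
    obtain ⟨hea, habs⟩ := div_mul_cancel_and_abs_div_le hb hf hle
    obtain ⟨h1, h2⟩ := abs_le.1 habs
    have hfb : 0 < f / b := div_pos hf hb
    -- `y` is the combination `q r - s r'`, and `-r' = -(r r') r⁻¹` with `-(r r') > 0`
    set q := (f / b + e / a) / 2 with hq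
    set s := (f / b - e / a) / 2 with hs'
    have hq0 : 0 ≤ q := by linarith
    have hs0' : 0 ≤ s := by linarith
    have hqs : 0 < q + s * -(a ^ 2 - p * b ^ 2) := by
      rcases hq0.eq_or_lt with h | h
      · have : 0 < s := by linarith
        rw [← h, zero_add]; exact mul_pos this hn
      · exact add_pos_of_pos_of_nonneg h (mul_nonneg hs0' hn.le)
    refine hy.cutsIntoSimilar ?_
    convert ratioCuts_combination hr hq0 (mul_nonneg hs0' hn.le) hqs using 1
    rw [Rat.cast_mul, Rat.cast_neg, ← hnorm, mul_comm ((a : ℝ) + _), ← neg_mul, mul_assoc,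
      mul_assoc, mul_inv_cancel₀ hr.ne', mul_one]
    have e1 : (f : ℝ) = (q + s) * b := by
      have : f = (q + s) * b := by rw [hq, hs']; field_simp; ring
      exact_mod_cast this
    have e2 : (e : ℝ) = (q - s) * a := by
      have : e = (q - s) * a := by rw [hq, hs']; linear_combination -hea
      exact_mod_cast this
    rw [e1, e2]; ring
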